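/- Let $N\ge 1$, $n>N$, $p\ge 0$ be integers, let $X\in\mathbb R^{n\times N}$ and $Y\in\mathbb R^{p\times N}$ be data matrices, and let $W_{\min}:=YX^{\mathsf T}(XX^{\mathsf T})^{+}$, where $A^+$ is the Moore–Penrose pseudoinverse of $A$ (so $W_{\min}$ is the minimum norm solution of $WX=Y$ whenever this equation is solvable). Let $B_t\ge 1$ ($t=0,1,2,\dots$) be integers (batch sizes), $\eta_t\ge 0$ learning rates and $\sigma_t\in\mathbb R$ noise levels. For each $t$ let $A_t\in\mathbb R^{N\times B_t}$ be a random matrix whose columns are i.i.d. uniformly distributed on the standard basis vectors of $\mathbb R^N$, and let $G_t\in\mathbb R^{n\times B_t}$ be a random matrix with i.i.d. standard Gaussian entries, all columns of all the $A_t$ and all entries of all the $G_t$ being mutually independent. With $c_t:=\sqrt{N/B_t}$ put $$X_t:=c_t(XA_t+\sigma_tG_t),\qquad Y_t:=c_tYA_t .$$ For an arbitrary deterministic $W_0\in\mathbb R^{p\times n}$, define minibatch SGD with additive Gaussian noise by $$W_{t+1}:=W_t+\frac{2\eta_t}{N}\,(Y_t-W_tX_t)X_t^{\mathsf T},\qquad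 t\ge 0 .$$ Suppose that $\sigma_t^2$ is non-increasing with $\sigma_t^2\to 0$, that $\eta_t\to 0$, that $$\sum_{t=0}^\infty(\eta_t\sigma_t^2-C\eta_t^2)=\infty\quad\text{for every } C>0,\qquad\text{and that}\qquad \sum_{t=0}^\infty\eta_t^2\sigma_t^2<\infty .$$ (The first condition means that the partial sums tend to $+\infty$.) Then $W_t\to W_{\min}$ in probability. If, in addition, $\eta_t=\Theta(t^{-x})$ and $\sigma_t^2=\Theta(t^{-y})$ as $t\to\infty$, where $x,y>0$ and $x+y<1<2x+y$, then for every $\epsilon>0$ $$t^{\min\{y,\,x/2\}-\epsilon}\,\|W_t-W_{\min}\|_F\to 0\quad\text{in probability},$$ where $\|\cdot\|_F$ is the Frobenius norm. -/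

import Mathlib

open MeasureTheory ProbabilityTheory Filter Topology Asymptotics
open scoped Matrix Matrix.Norms.Frobenius

/-- The four Penrose equations: `P` is the Moore-Penrose pseudoinverse of the real matrix `A`. -/
structure IsMoorePenrose {m n : ℕ} (A : Matrix (Fin m) (Fin n) ℝ)
    (P : Matrix (Fin n) (Fin m) ℝ) : Prop where
  mul_mul_self : A * P * A = A
  self_mul_mul : P * A * P = P
  symm_left : (A * P)ᵀ = A * P
  symm_right : (P * A)ᵀ = P * A

theorem IsMoorePenrose.unique {m n : ℕ} {A : Matrix (Fin m) (Fin n) ℝ}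
    {P R : Matrix (Fin n) (Fin m) ℝ} (hP : IsMoorePenrose A P) (hR : IsMoorePenrose A R) :
    P = R := by
  have h1 : A * P = A * R := by
    calc A * P = (A * P)ᵀ := hP.symm_left.symm
      _ = ((A * R) * (A * P))ᵀ := by
          rw [← Matrix.mul_assoc, hR.mul_mul_self]
      _ = (A * P) * (A * R) := by rw [Matrix.transpose_mul, hP.symm_left, hR.symm_left]
      _ = A * R := by rw [← Matrix.mul_assoc, hP.mul_mul_self]
  have h2 : P * A = R * A := by
    calc P * A = (P * A)ᵀ := hP.symm_right.symm
      _ = ((P * A) * (R * A))ᵀ := by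
          rw [Matrix.mul_assoc P A (R * A), ← Matrix.mul_assoc A R A, hR.mul_mul_self]
      _ = (R * A) * (P * A) := by rw [Matrix.transpose_mul, hP.symm_right, hR.symm_right]
      _ = R * A := by rw [Matrix.mul_assoc R A (P * A), ← Matrix.mul_assoc A P A, hP.mul_mul_self]
  calc P = P * A * P := hP.self_mul_mul.symm
    _ = R * (A * P) := by rw [h2, Matrix.mul_assoc]
    _ = R * A * R := by rw [h1, Matrix.mul_assoc]
    _ = R := hR.self_mul_mul

theorem exists_isMoorePenrose {m n : ℕ} (A : Matrix (Fin m) (Fin n) ℝ) :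
    ∃ P, IsMoorePenrose A P := by
  have hM : (Aᵀ * A).IsHermitian := by
    simp [Matrix.IsHermitian, Matrix.conjTranspose_eq_transpose_of_trivial, Matrix.transpose_mul]
  obtain ⟨S, hS, hc, h1, h2⟩ : ∃ S : Matrix (Fin n) (Fin n) ℝ, Sᵀ = S ∧
      S * (Aᵀ * A) = (Aᵀ * A) * S ∧ (Aᵀ * A) * S * (Aᵀ * A) = Aᵀ * A ∧
      S * (Aᵀ * A) * S = S := by
    have hsp := hM.spectral_theorem
    set φ := Unitary.conjStarAlgAut ℝ _ hM.eigenvectorUnitary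
    set d : Fin n → ℝ := RCLike.ofReal ∘ hM.eigenvalues
    have key : ∀ a : ℝ, a * a⁻¹ * a = a ∧ a⁻¹ * a * a⁻¹ = a⁻¹ := by
      intro a
      by_cases h : a = 0
      · simp [h]
      · simp [h]
    refine ⟨φ (Matrix.diagonal fun i => (d i)⁻¹), ?_, ?_, ?_, ?_⟩
    · rw [← Matrix.conjTranspose_eq_transpose_of_trivial, ← Matrix.star_eq_conjTranspose,
        ← map_star, Matrix.star_eq_conjTranspose, Matrix.diagonal_conjTranspose]
      simp
    · rw [hsp, ← map_mul, ← map_mul, Matrix.diagonal_mul_diagonal, Matrix.diagonal_mul_diagonal]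
      simp_rw [mul_comm]
    · rw [hsp, ← map_mul, ← map_mul, Matrix.diagonal_mul_diagonal, Matrix.diagonal_mul_diagonal]
      simp_rw [(key _).1]
    · rw [hsp, ← map_mul, ← map_mul, Matrix.diagonal_mul_diagonal, Matrix.diagonal_mul_diagonal]
      simp_rw [(key _).2]
  have h3 : A * (S * (Aᵀ * A)) = A := by
    have : (A * (S * (Aᵀ * A)) - A)ᴴ * (A * (S * (Aᵀ * A)) - A) = 0 := by
      have e : A * (S * (Aᵀ * A)) - A = A * (S * (Aᵀ * A) - 1) := by
        rw [Matrix.mul_sub, Matrix.mul_one]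
      rw [e, Matrix.conjTranspose_eq_transpose_of_trivial, Matrix.transpose_mul,
        Matrix.mul_assoc, ← Matrix.mul_assoc Aᵀ A, Matrix.mul_sub (Aᵀ * A), ← Matrix.mul_assoc (Aᵀ * A),
        h1, Matrix.mul_one, sub_self, Matrix.mul_zero]
    exact sub_eq_zero.mp (Matrix.conjTranspose_mul_self_eq_zero.mp this)
  refine ⟨S * Aᵀ, ?_, ?_, ?_, ?_⟩
  · rw [← h3]
    simp only [Matrix.mul_assoc] at h3 ⊢
    simp only [h3]
  · rw [Matrix.mul_assoc S Aᵀ A, ← Matrix.mul_assoc, h2]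
  · simp [Matrix.transpose_mul, hS, Matrix.mul_assoc]
  · rw [Matrix.mul_assoc, Matrix.transpose_mul, hS, Matrix.transpose_mul, Matrix.transpose_transpose,
      hc]

/-- The Moore-Penrose pseudoinverse `A⁺` of a real matrix. -/
noncomputable def pinv {m n : ℕ} (A : Matrix (Fin m) (Fin n) ℝ) : Matrix (Fin n) (Fin m) ℝ :=
  Classical.choose (exists_isMoorePenrose A)

theorem isMoorePenrose_pinv {m n : ℕ} (A : Matrix (Fin m) (Fin n) ℝ) :
    IsMoorePenrose A (pinv A) :=
  Classical.choose_spec (exists_isMoorePenrose A)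

/-- `W_min = Y Xᵀ (X Xᵀ)⁺`, the minimum norm least squares solution of `Y = W X` (the minimum
norm solution, when the equation is solvable). -/
noncomputable def minNormSol {n p N : ℕ} (X : Matrix (Fin n) (Fin N) ℝ)
    (Y : Matrix (Fin p) (Fin N) ℝ) : Matrix (Fin p) (Fin n) ℝ :=
  Y * Xᵀ * pinv (X * Xᵀ)

/-- The `N × b` matrix whose `j`-th column is the standard basis vector `e_{k j}`. -/
def selectionMatrix {N b : ℕ} (k : Fin b → Fin N) : Matrix (Fin N) (Fin b) ℝ :=
  Matrix.of fun i j => if i = k j then 1 else 0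

/-- `X_t = c_t (X A_t + σ_t G_t)` with `c_t = √(N / b)`, where `A_t` selects the columns `k`. -/
noncomputable def batchX {n N b : ℕ} (X : Matrix (Fin n) (Fin N) ℝ) (s : ℝ)
    (k : Fin b → Fin N) (g : Matrix (Fin n) (Fin b) ℝ) : Matrix (Fin n) (Fin b) ℝ :=
  √((N : ℝ) / b) • (X * selectionMatrix k + s • g)

/-- `Y_t = c_t Y A_t`. -/
noncomputable def batchY {p N b : ℕ} (Y : Matrix (Fin p) (Fin N) ℝ)
    (k : Fin b → Fin N) : Matrix (Fin p) (Fin b) ℝ :=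
  √((N : ℝ) / b) • (Y * selectionMatrix k)

/-- The trajectory of minibatch SGD with additive noise, for one realization of the batches
`k t : Fin (B t) → Fin N` and of the noise matrices `g t`:
`W_{t+1} = W_t + (2 η_t / N) (Y_t - W_t X_t) X_tᵀ`. -/
noncomputable def sgdPath {n p N : ℕ} {B : ℕ → ℕ} (X : Matrix (Fin n) (Fin N) ℝ)
    (Y : Matrix (Fin p) (Fin N) ℝ) (η σ : ℕ → ℝ) (W₀ : Matrix (Fin p) (Fin n) ℝ)
    (k : (t : ℕ) → Fin (B t) → Fin N) (g : (t : ℕ) → Matrix (Fin n) (Fin (B t)) ℝ) :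
    ℕ → Matrix (Fin p) (Fin n) ℝ
  | 0 => W₀
  | t + 1 =>
    let W := sgdPath X Y η σ W₀ k g t
    let Xt := batchX X (σ t) (k t) (g t)
    let Yt := batchY Y (k t)
    W + (2 * η t / N) • ((Yt - W * Xt) * Xtᵀ)

/-- The law of the randomness: every batch element `k t j` is uniform on the `N` datapoints, every
entry `g t i j` of the noise is standard Gaussian, and all these random variables, over all times
`t` and all positions, are mutually independent. -/
structure IsBatchNoise {Ω : Type*} [MeasurableSpace Ω] (μ : Measure Ω) {n N : ℕ} {B : ℕ → ℕ}
    (k : (t : ℕ) → Fin (B t) → Ω → Fin N)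
    (g : (t : ℕ) → Fin n → Fin (B t) → Ω → ℝ) : Prop where
  measurable_k : ∀ t j, Measurable (k t j)
  measurable_g : ∀ t i j, Measurable (g t i j)
  law_k : ∀ t j, μ.map (k t j) = uniformOn Set.univ
  law_g : ∀ t i j, μ.map (g t i j) = gaussianReal 0 1
  indep : iIndep
    (Sum.elim
      (fun a : Σ t, Fin (B t) => MeasurableSpace.comap (k a.1 a.2) inferInstance)
      (fun a : Σ t, Fin n × Fin (B t) =>
        MeasurableSpace.comap (g a.1 a.2.1 a.2.2) inferInstance)) μ

/-- The random iterates `W_t`. -/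
noncomputable def sgdIterate {Ω : Type*} {n p N : ℕ} {B : ℕ → ℕ} (X : Matrix (Fin n) (Fin N) ℝ)
    (Y : Matrix (Fin p) (Fin N) ℝ) (η σ : ℕ → ℝ) (W₀ : Matrix (Fin p) (Fin n) ℝ)
    (k : (t : ℕ) → Fin (B t) → Ω → Fin N) (g : (t : ℕ) → Fin n → Fin (B t) → Ω → ℝ)
    (t : ℕ) (ω : Ω) : Matrix (Fin p) (Fin n) ℝ :=
  sgdPath X Y η σ W₀ (fun s j => k s j ω) (fun s => Matrix.of fun i j => g s i j ω) t

/-! The rows of the iterate evolve separately. Fix one row `w`, let `w'` be the same row of the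
minimum norm solution and `S` the span of the data points. Averaged over the minibatch, a step is
gradient descent for ridge regression with penalty `σ²`: the Gaussian noise adds exactly `-σ² w` to
the mean direction (`hasIntegral_residual_mul_inner`). Since `w'` lies in `S` and solves the normal
equations, the error can be studied separately along `S` and `Sᗮ`; let `a` and `u` be the mean
squares of the two components.

In `S` the data term is coercive, so `a` contracts at a rate of order `η`, while the ridge bias
costs `η σ⁴` and the sampling noise `η²`. In `Sᗮ` only the ridge term contracts, at rate of order `η
σ²`, but there every sample reduces to `σ` times a Gaussian vector, so the noise costs only `η² σ²`.
The noise grows with the current error, which couples the two recursions through a factor `1 + a +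
u` (`exists_moment_recursion`).

Divided by the contraction rate, the forcing is of order `σ⁴ + η` in `S` and `η` in `Sᗮ`, hence
tends to zero. So `a` and `u` are bounded, and then tend to zero because `∑ η σ²` diverges
(`tendsto_zero_of_moment_recursion`). For power laws the same quotients give the decay `t ^ (-min
(2y) x)` (`exists_rate_of_moment_recursion`). Chebyshev's inequality passes from mean squares to
probability. -/

/-! ### Deterministic recursive inequalities -/

/-- A nonnegative sequence that is repeatedly averaged against a null sequence, with weights whose
sum diverges, tends to zero. -/
theorem tendsto_zero_of_le_convex_comb {z α δ : ℕ → ℝ} (hz : ∀ t, 0 ≤ z t)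
    (hα0 : ∀ t, 0 ≤ α t) (hα1 : ∀ᶠ t in atTop, α t ≤ 1)
    (hα : Tendsto (fun T : ℕ => ∑ t ∈ Finset.range T, α t) atTop atTop)
    (hδ : Tendsto δ atTop (𝓝 0))
    (hrec : ∀ᶠ t in atTop, z (t + 1) ≤ (1 - α t) * z t + α t * δ t) :
    Tendsto z atTop (𝓝 0) := by
  rw [Metric.tendsto_atTop']
  intro ε hε
  have h1 : ∀ᶠ t in atTop, δ t ≤ ε / 2 := hδ.eventually_le_const (by linarith)
  obtain ⟨T, hT⟩ := eventually_atTop.1 (hα1.and (hrec.and h1))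
  -- Beyond `T`, the excess over `ε / 2` is multiplied by at most `1 - α ≤ exp (-α)` at each step.
  have hbound : ∀ m : ℕ, z (T + m) - ε / 2 ≤
      Real.exp (∑ t ∈ Finset.range T, α t - ∑ t ∈ Finset.range (T + m), α t) * z T := by
    intro m
    induction m with
    | zero => simp; linarith
    | succ m ih =>
      obtain ⟨ha, hr, hd⟩ := hT (T + m) (by omega)
      rw [← add_assoc, Finset.sum_range_succ]
      have h2 : 1 - α (T + m) ≤ Real.exp (-α (T + m)) := by
        have := Real.add_one_le_exp (-α (T + m)); linarith
      have h3 : α (T + m) * δ (T + m) ≤ α (T + m) * (ε / 2) :=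
        mul_le_mul_of_nonneg_left hd (hα0 _)
      have h4 : z (T + m + 1) - ε / 2 ≤ (1 - α (T + m)) * (z (T + m) - ε / 2) := by
        linarith
      have h5 := mul_le_mul_of_nonneg_left ih (sub_nonneg.2 ha)
      refine h4.trans (h5.trans ?_)
      rw [← mul_assoc]
      refine mul_le_mul_of_nonneg_right ?_ (hz T)
      calc _ ≤ Real.exp (-α (T + m)) * _ := mul_le_mul_of_nonneg_right h2 (Real.exp_pos _).le
        _ = _ := by rw [← Real.exp_add]; congr 1; ring
  have hlim : Tendsto (fun t : ℕ =>
      Real.exp (∑ i ∈ Finset.range T, α i - ∑ i ∈ Finset.range t, α i) * z T) atTop (𝓝 0) := by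
    have h6 : Tendsto (fun t : ℕ => ∑ i ∈ Finset.range T, α i - ∑ i ∈ Finset.range t, α i)
        atTop atBot := by
      simpa [sub_eq_add_neg] using
        tendsto_atBot_add_const_left _ (∑ i ∈ Finset.range T, α i) (tendsto_neg_atTop_atBot.comp hα)
    simpa using (Real.tendsto_exp_atBot.comp h6).mul_const (z T)
  obtain ⟨T', hT'⟩ := eventually_atTop.1 (hlim.eventually_lt_const (half_pos hε))
  refine ⟨max T T', fun t ht => ?_⟩
  have ht1 : T ≤ t := (le_max_left _ _).trans ht.le
  have h7 := hbound (t - T)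
  rw [Nat.add_sub_cancel' ht1] at h7
  have h8 := hT' t ((le_max_right _ _).trans ht.le)
  rw [Real.dist_eq, sub_zero, abs_of_nonneg (hz t)]
  linarith

/-- Two coupled sequences, each averaged against a small multiple of `1 + a + u`, stay bounded. -/
theorem exists_bound_of_coupled_convex_comb {a u α β δ δ' : ℕ → ℝ}
    (ha0 : ∀ t, 0 ≤ a t) (hu0 : ∀ t, 0 ≤ u t)
    (hα0 : ∀ t, 0 ≤ α t) (hα1 : ∀ᶠ t in atTop, α t ≤ 1)
    (hβ0 : ∀ t, 0 ≤ β t) (hβ1 : ∀ᶠ t in atTop, β t ≤ 1)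
    (hδ : Tendsto δ atTop (𝓝 0)) (hδ' : Tendsto δ' atTop (𝓝 0))
    (ha : ∀ t, a (t + 1) ≤ (1 - α t) * a t + α t * (δ t * (1 + a t + u t)))
    (hu : ∀ t, u (t + 1) ≤ (1 - β t) * u t + β t * (δ' t * (1 + a t + u t))) :
    ∃ A, 1 ≤ A ∧ ∀ᶠ t in atTop, a t ≤ A ∧ u t ≤ A := by
  -- The threshold `1 / 3` closes the induction: if `a, u ≤ A` and `1 ≤ A`, then `1 + a + u ≤ 3 *
  -- A`.
  obtain ⟨T, hT⟩ := eventually_atTop.1 (hα1.and (hβ1.and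
    ((hδ.eventually_le_const (show (0 : ℝ) < 1 / 3 by norm_num)).and
      (hδ'.eventually_le_const (show (0 : ℝ) < 1 / 3 by norm_num)))))
  refine ⟨max 1 (max (a T) (u T)), le_max_left _ _, ?_⟩
  set A := max 1 (max (a T) (u T))
  have hA1 : 1 ≤ A := le_max_left _ _
  have step : ∀ {α δ x s : ℝ}, 0 ≤ α → α ≤ 1 → δ ≤ 1 / 3 → x ≤ A → 0 ≤ s → s ≤ 3 * A →
      (1 - α) * x + α * (δ * s) ≤ A := by
    intro α δ x s h0 h1 h2 h3 h4 h5
    have h6 : δ * s ≤ A := by nlinarith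
    nlinarith
  refine eventually_atTop.2 ⟨T, fun t ht => ?_⟩
  induction t, ht using Nat.le_induction with
  | base => exact ⟨(le_max_left _ _).trans (le_max_right _ _),
      (le_max_right _ _).trans (le_max_right _ _)⟩
  | succ t ht ih =>
    obtain ⟨h1, h2, h3, h4⟩ := hT t ht
    have hs : 0 ≤ 1 + a t + u t := by linarith [ha0 t, hu0 t]
    have hs' : 1 + a t + u t ≤ 3 * A := by linarith [ih.1, ih.2]
    exact ⟨(ha t).trans (step (hα0 t) h1 h3 ih.1 hs hs'),
      (hu t).trans (step (hβ0 t) h2 h4 ih.2 hs hs')⟩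

/-- Polynomial decay from a recursion with polynomially decaying contraction and forcing. -/
theorem exists_le_rpow_of_recursion {z : ℕ → ℝ} {c K q r : ℝ} (hc : 0 < c) (hK : 0 ≤ K)
    (hq0 : 0 < q) (hq : q < 1) (hr : 0 ≤ r)
    (hrec : ∀ᶠ t : ℕ in atTop, z (t + 1) ≤
      (1 - c * (t : ℝ) ^ (-q)) * z t + K * ((t : ℝ) ^ (-q) * (t : ℝ) ^ (-r))) :
    ∃ D, 0 ≤ D ∧ ∀ᶠ t : ℕ in atTop, z t ≤ D * (t : ℝ) ^ (-r) := by
  -- As `q < 1`, the relative decrease `r / t` of `t ^ (-r)` is eventually at most half of the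
  -- contraction `c * t ^ (-q)`.
  have h1 : Tendsto (fun t : ℕ => r * (t : ℝ) ^ (-(1 - q))) atTop (𝓝 0) := by
    simpa using ((tendsto_rpow_neg_atTop (sub_pos.2 hq)).comp
      tendsto_natCast_atTop_atTop).const_mul r
  have h2 : Tendsto (fun t : ℕ => c * (t : ℝ) ^ (-q)) atTop (𝓝 0) := by
    simpa using ((tendsto_rpow_neg_atTop hq0).comp tendsto_natCast_atTop_atTop).const_mul c
  obtain ⟨T, hT⟩ := eventually_atTop.1 ((h1.eventually_le_const (half_pos hc)).and
    ((h2.eventually_le_const one_pos).and (hrec.and (eventually_ge_atTop 1))))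
  have hT1 : 1 ≤ T := (hT T le_rfl).2.2.2
  -- The first entry makes the forcing at most the other half of the contraction of `D * t ^ (-r)`;
  -- the second gives the base case.
  set D := max (2 * K / c) (z T * (T : ℝ) ^ r) with hD
  have hD1 : 2 * K / c ≤ D := le_max_left _ _
  have hD0 : 0 ≤ D := le_trans (by positivity) hD1
  refine ⟨D, hD0, eventually_atTop.2 ⟨T, fun t ht => ?_⟩⟩
  induction t, ht using Nat.le_induction with
  | base =>
    have hTp : (0 : ℝ) < T := by exact_mod_cast hT1
    rw [Real.rpow_neg hTp.le, ← div_eq_mul_inv, le_div_iff₀ (by positivity)]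
    exact le_max_right _ _
  | succ t ht ih =>
    obtain ⟨hr1, hc1, hrec1, -⟩ := hT t ht
    have htp : (0 : ℝ) < t := by exact_mod_cast (hT1.trans ht)
    have hb : (t : ℝ) ^ (-r) * (1 - r / t) ≤ ((t + 1 : ℕ) : ℝ) ^ (-r) := by
      have e : ((t + 1 : ℕ) : ℝ) = t * (1 + 1 / t) := by push_cast; field_simp
      rw [e, Real.mul_rpow htp.le (by positivity)]
      refine mul_le_mul_of_nonneg_left ?_ (by positivity)
      rw [Real.rpow_def_of_pos (by positivity)]
      have hl : Real.log (1 + 1 / (t : ℝ)) ≤ 1 / t := by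
        have := Real.log_le_sub_one_of_pos (show (0 : ℝ) < 1 + 1 / t by positivity); linarith
      have := Real.add_one_le_exp (Real.log (1 + 1 / (t : ℝ)) * -r)
      have h5 := mul_le_mul_of_nonneg_right hl hr
      have e2 : r / (t : ℝ) = 1 / t * r := by ring
      rw [e2]; linarith
    have hrt : r / (t : ℝ) = (t : ℝ) ^ (-q) * (r * (t : ℝ) ^ (-(1 - q))) := by
      have : (t : ℝ) ^ (-q) * (t : ℝ) ^ (-(1 - q)) = (t : ℝ)⁻¹ := by
        rw [← Real.rpow_add htp, ← Real.rpow_neg_one]; congr 1; ring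
      rw [mul_left_comm, this, div_eq_mul_inv]
    have hKD : K ≤ c / 2 * D := by
      rw [div_le_iff₀ hc] at hD1; linarith
    have hp : 0 ≤ (t : ℝ) ^ (-r) := by positivity
    have hpq : 0 ≤ (t : ℝ) ^ (-q) := by positivity
    calc z (t + 1) ≤ _ := hrec1
      _ ≤ (1 - c * (t : ℝ) ^ (-q)) * (D * (t : ℝ) ^ (-r)) +
          (c / 2 * D) * ((t : ℝ) ^ (-q) * (t : ℝ) ^ (-r)) := by
          refine add_le_add (mul_le_mul_of_nonneg_left ih (by linarith))
            (mul_le_mul_of_nonneg_right hKD (by positivity))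
      _ = D * ((t : ℝ) ^ (-r) * (1 - (t : ℝ) ^ (-q) * (c / 2))) := by ring
      _ ≤ D * ((t : ℝ) ^ (-r) * (1 - r / t)) := by
          rw [hrt]
          gcongr
      _ ≤ D * ((t + 1 : ℕ) : ℝ) ^ (-r) := mul_le_mul_of_nonneg_left hb hD0

/-! ### Moments of a single noisy sample -/

/-- A uniform index `κ` and a standard Gaussian vector `γ`; only pairwise independence of the index
and the coordinates is required. -/
structure IsUniformGaussianPair {Ω : Type*} [MeasurableSpace Ω] (μ : Measure Ω) {n N : ℕ}
    (κ : Ω → Fin N) (γ : Ω → EuclideanSpace ℝ (Fin n)) : Prop where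
  measurable_fst : Measurable κ
  measurable_snd : Measurable γ
  law_fst : μ.map κ = uniformOn Set.univ
  law_snd : ∀ i, μ.map (fun ω => γ ω i) = gaussianReal 0 1
  indep_fst : ∀ i, IndepFun κ (fun ω => γ ω i) μ
  indep_snd : ∀ i j, i ≠ j → IndepFun (fun ω => γ ω i) (fun ω => γ ω j) μ

theorem integrable_pow_gaussianReal (m : ℕ) : Integrable (fun x : ℝ => x ^ m) (gaussianReal 0 1) := by
  have h := (memLp_id_gaussianReal (μ := 0) (v := 1) (m : NNReal)).integrable_norm_pow' 
  refine h.mono' (by fun_prop) (ae_of_all _ fun x => ?_)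
  simp

theorem integral_sq_gaussianReal : ∫ x : ℝ, x ^ 2 ∂(gaussianReal 0 1) = 1 := by
  have h := variance_of_integral_eq_zero (μ := gaussianReal 0 1) (X := id) aemeasurable_id
    (by simp [integral_id_gaussianReal])
  rw [variance_id_gaussianReal] at h
  simpa using h.symm

/-- A bound for the second moment of `1 + ‖γ‖²`, where `γ` is a standard Gaussian vector. -/
noncomputable def gaussianMomentBound (n : ℕ) : ℝ :=
  2 + 2 * (n * (n * ∫ x : ℝ, x ^ 4 ∂(gaussianReal 0 1)))

theorem gaussianMomentBound_nonneg (n : ℕ) : 0 ≤ gaussianMomentBound n := by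
  have : 0 ≤ ∫ x : ℝ, x ^ 4 ∂(gaussianReal 0 1) := integral_nonneg fun x => by positivity
  unfold gaussianMomentBound
  positivity

namespace IsUniformGaussianPair

variable {Ω : Type*} [MeasurableSpace Ω] {μ : Measure Ω} {n N : ℕ}
  {κ : Ω → Fin N} {γ : Ω → EuclideanSpace ℝ (Fin n)}

theorem measurable_coord (h : IsUniformGaussianPair μ κ γ) (i : Fin n) :
    Measurable fun ω => γ ω i := by
  have := h.measurable_snd
  fun_prop

theorem indepFun_index_coord (h : IsUniformGaussianPair μ κ γ) (f : Fin N → ℝ) (i : Fin n) :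
    IndepFun (fun ω => f (κ ω)) (fun ω => γ ω i) μ :=
  (h.indep_fst i).comp (measurable_of_finite f) measurable_id

theorem integrable_coord_pow (h : IsUniformGaussianPair μ κ γ) (i : Fin n) (m : ℕ) :
    Integrable (fun ω => γ ω i ^ m) μ := by
  have h1 := integrable_pow_gaussianReal m
  rw [← h.law_snd i] at h1
  exact h1.comp_measurable (h.measurable_coord i)

theorem integral_coord_pow (h : IsUniformGaussianPair μ κ γ) (i : Fin n) (m : ℕ) :
    ∫ ω, γ ω i ^ m ∂μ = ∫ x, x ^ m ∂(gaussianReal 0 1) := by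
  rw [← h.law_snd i, integral_map (h.measurable_coord i).aemeasurable (by fun_prop)]

theorem integrable_coord (h : IsUniformGaussianPair μ κ γ) (i : Fin n) :
    Integrable (fun ω => γ ω i) μ := by
  simpa using h.integrable_coord_pow i 1

theorem integral_coord (h : IsUniformGaussianPair μ κ γ) (i : Fin n) : ∫ ω, γ ω i ∂μ = 0 := by
  simpa using h.integral_coord_pow i 1

theorem integrable_coord_mul_coord (h : IsUniformGaussianPair μ κ γ) (i j : Fin n) :
    Integrable (fun ω => γ ω i * γ ω j) μ := by
  rcases eq_or_ne i j with rfl | hij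
  · simpa [sq] using h.integrable_coord_pow i 2
  · exact (h.indep_snd i j hij).integrable_mul (h.integrable_coord i) (h.integrable_coord j)

theorem integral_coord_mul_coord (h : IsUniformGaussianPair μ κ γ) (i j : Fin n) :
    ∫ ω, γ ω i * γ ω j ∂μ = if i = j then 1 else 0 := by
  split_ifs with hij
  · subst hij
    simpa [sq] using (h.integral_coord_pow i 2).trans integral_sq_gaussianReal
  · rw [(h.indep_snd i j hij).integral_fun_mul_eq_mul_integral
      (h.measurable_coord i).aestronglyMeasurable (h.measurable_coord j).aestronglyMeasurable,
      h.integral_coord, zero_mul]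

theorem inner_mul_inner_eq_sum (w q g : EuclideanSpace ℝ (Fin n)) :
    inner ℝ w g * inner ℝ q g = ∑ i, ∑ j, w i * q j * (g i * g j) := by
  simp only [PiLp.inner_apply, RCLike.inner_apply, conj_trivial, Finset.sum_mul_sum]
  exact Finset.sum_congr rfl fun i _ => Finset.sum_congr rfl fun j _ => by ring

theorem integrable_inner_mul_inner (h : IsUniformGaussianPair μ κ γ)
    (w q : EuclideanSpace ℝ (Fin n)) :
    Integrable (fun ω => inner ℝ w (γ ω) * inner ℝ q (γ ω)) μ := by
  simp only [inner_mul_inner_eq_sum]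
  exact integrable_finsetSum _ fun i _ => integrable_finsetSum _ fun j _ =>
    (h.integrable_coord_mul_coord i j).const_mul _

theorem integral_inner_mul_inner (h : IsUniformGaussianPair μ κ γ)
    (w q : EuclideanSpace ℝ (Fin n)) :
    ∫ ω, inner ℝ w (γ ω) * inner ℝ q (γ ω) ∂μ = inner ℝ w q := by
  simp only [inner_mul_inner_eq_sum]
  rw [integral_finsetSum _ fun i _ => integrable_finsetSum _ fun j _ =>
    (h.integrable_coord_mul_coord i j).const_mul _]
  simp only [integral_finsetSum _ fun j _ => (h.integrable_coord_mul_coord _ j).const_mul _,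
    integral_const_mul, h.integral_coord_mul_coord]
  simp [PiLp.inner_apply, mul_comm]

/-- Cauchy–Schwarz reduces the fourth moment of the norm to fourth moments of the coordinates, so no
joint law of the coordinates is needed. -/
theorem one_add_norm_sq_sq_le (g : EuclideanSpace ℝ (Fin n)) :
    (1 + ‖g‖ ^ 2) ^ 2 ≤ 2 + 2 * (n * ∑ i, g i ^ 4) := by
  have h1 : (∑ i, g i ^ 2) ^ 2 ≤ n * ∑ i, (g i ^ 2) ^ 2 := by
    simpa using sq_sum_le_card_mul_sum_sq (s := (Finset.univ : Finset (Fin n))) (f := fun i => g i ^ 2)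
  have h2 : ‖g‖ ^ 2 = ∑ i, g i ^ 2 := by simp [EuclideanSpace.norm_sq_eq]
  simp only [← pow_mul] at h1
  rw [h2]
  nlinarith [sq_nonneg (1 - ∑ i, g i ^ 2)]

variable [IsProbabilityMeasure μ]

theorem integral_index (h : IsUniformGaussianPair μ κ γ) (f : Fin N → ℝ) :
    ∫ ω, f (κ ω) ∂μ = (∑ k, f k) / N := by
  have hf : AEStronglyMeasurable f (μ.map κ) := (measurable_of_finite f).aestronglyMeasurable
  have : IsProbabilityMeasure (μ.map κ) := Measure.isProbabilityMeasure_map h.measurable_fst.aemeasurable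
  rw [← integral_map h.measurable_fst.aemeasurable hf, integral_fintype Integrable.of_finite,
    h.law_fst, Finset.sum_div]
  refine Finset.sum_congr rfl fun k _ => ?_
  rw [measureReal_def, uniformOn_univ]
  simp [div_eq_inv_mul]

theorem integrable_index (h : IsUniformGaussianPair μ κ γ) (f : Fin N → ℝ) :
    Integrable (fun ω => f (κ ω)) μ := by
  have : IsProbabilityMeasure (μ.map κ) := Measure.isProbabilityMeasure_map h.measurable_fst.aemeasurable
  exact (Integrable.of_finite (f := f) (μ := μ.map κ)).comp_measurable h.measurable_fst

theorem integrable_index_mul_inner (h : IsUniformGaussianPair μ κ γ) (f : Fin N → ℝ)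
    (q : EuclideanSpace ℝ (Fin n)) : Integrable (fun ω => f (κ ω) * inner ℝ q (γ ω)) μ := by
  simp only [PiLp.inner_apply, RCLike.inner_apply, conj_trivial, Finset.mul_sum, ← mul_assoc]
  exact integrable_finsetSum _ fun i _ =>
    ((h.indepFun_index_coord f i).integrable_mul (h.integrable_index f)
      (h.integrable_coord i)).mul_const _

theorem integral_index_mul_inner (h : IsUniformGaussianPair μ κ γ) (f : Fin N → ℝ)
    (q : EuclideanSpace ℝ (Fin n)) : ∫ ω, f (κ ω) * inner ℝ q (γ ω) ∂μ = 0 := by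
  simp only [PiLp.inner_apply, RCLike.inner_apply, conj_trivial, Finset.mul_sum, ← mul_assoc]
  refine (integral_finsetSum _ fun i _ =>
    ((h.indepFun_index_coord f i).integrable_mul (h.integrable_index f)
      (h.integrable_coord i)).mul_const _).trans ?_
  refine Finset.sum_eq_zero fun i _ => ?_
  rw [integral_mul_const, (h.indepFun_index_coord f i).integral_mul_eq_mul_integral
    (h.integrable_index f).aestronglyMeasurable (h.integrable_coord i).aestronglyMeasurable,
    h.integral_coord, mul_zero, zero_mul]

theorem integrable_sum_coord_pow_four (h : IsUniformGaussianPair μ κ γ) :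
    Integrable (fun ω => 2 + 2 * (n * ∑ i, γ ω i ^ 4)) μ :=
  (integrable_const _).add (((integrable_finsetSum _ fun i _ =>
    h.integrable_coord_pow i 4).const_mul _).const_mul _)

theorem integrable_one_add_norm_sq_sq (h : IsUniformGaussianPair μ κ γ) :
    Integrable (fun ω => (1 + ‖γ ω‖ ^ 2) ^ 2) μ := by
  have := h.measurable_snd
  refine h.integrable_sum_coord_pow_four.mono' (by fun_prop) (ae_of_all _ fun ω => ?_)
  rw [Real.norm_of_nonneg (by positivity)]
  exact one_add_norm_sq_sq_le _

theorem integral_one_add_norm_sq_sq_le (h : IsUniformGaussianPair μ κ γ) :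
    ∫ ω, (1 + ‖γ ω‖ ^ 2) ^ 2 ∂μ ≤ gaussianMomentBound n := by
  refine (integral_mono h.integrable_one_add_norm_sq_sq h.integrable_sum_coord_pow_four
    fun ω => one_add_norm_sq_sq_le _).trans_eq ?_
  rw [integral_add (integrable_const _) (((integrable_finsetSum _ fun i _ =>
    h.integrable_coord_pow i 4).const_mul _).const_mul _), integral_const_mul, integral_const_mul,
    integral_finsetSum _ fun i _ => h.integrable_coord_pow i 4]
  simp [h.integral_coord_pow, gaussianMomentBound]

/-- Sorted by degree in the noise: the linear terms have mean zero by independence of the index, and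
the quadratic term has mean `s ^ 2 * inner ℝ w q`. -/
theorem residual_mul_inner_eq (x : Fin N → EuclideanSpace ℝ (Fin n)) (y : Fin N → ℝ) (s : ℝ)
    (w q : EuclideanSpace ℝ (Fin n)) (k : Fin N) (g : EuclideanSpace ℝ (Fin n)) :
    (y k - inner ℝ w (x k + s • g)) * inner ℝ q (x k + s • g) =
      (y k - inner ℝ w (x k)) * inner ℝ q (x k) +
      (s * ((y k - inner ℝ w (x k)) * inner ℝ q g) - s * (inner ℝ q (x k) * inner ℝ w g) -
        s ^ 2 * (inner ℝ w g * inner ℝ q g)) := by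
  simp only [inner_add_right, inner_smul_right]
  ring

/-- Source of the implicit regularization: the mean is half the negative gradient at `w` of the
ridge loss with penalty `s ^ 2`, tested against `q`. -/
theorem hasIntegral_residual_mul_inner (h : IsUniformGaussianPair μ κ γ)
    (x : Fin N → EuclideanSpace ℝ (Fin n)) (y : Fin N → ℝ) (s : ℝ)
    (w q : EuclideanSpace ℝ (Fin n)) :
    Integrable (fun ω => (y (κ ω) - inner ℝ w (x (κ ω) + s • γ ω)) *
      inner ℝ q (x (κ ω) + s • γ ω)) μ ∧
    ∫ ω, (y (κ ω) - inner ℝ w (x (κ ω) + s • γ ω)) * inner ℝ q (x (κ ω) + s • γ ω) ∂μ =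
      (∑ k, (y k - inner ℝ w (x k)) * inner ℝ q (x k)) / N - s ^ 2 * inner ℝ w q := by
  simp only [residual_mul_inner_eq]
  have i0 := h.integrable_index fun k => (y k - inner ℝ w (x k)) * inner ℝ q (x k)
  have i1 := (h.integrable_index_mul_inner (fun k => y k - inner ℝ w (x k)) q).const_mul s
  have i2 := (h.integrable_index_mul_inner (fun k => inner ℝ q (x k)) w).const_mul s
  have i3 := (h.integrable_inner_mul_inner w q).const_mul (s ^ 2)
  refine ⟨i0.add ((i1.sub i2).sub i3), ?_⟩
  refine (integral_add i0 ((i1.sub i2).sub i3)).trans ?_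
  rw [integral_sub' (i1.sub i2) i3, integral_sub' i1 i2,
    integral_const_mul, integral_const_mul, integral_const_mul,
    h.integral_index_mul_inner (fun k => y k - inner ℝ w (x k)),
    h.integral_index_mul_inner (fun k => inner ℝ q (x k)),
    h.integral_inner_mul_inner, h.integral_index fun k => (y k - inner ℝ w (x k)) * inner ℝ q (x k)]
  ring

end IsUniformGaussianPair

/-! ### One step in mean square -/

/-- One step of noisy minibatch SGD for a single output coordinate. The data points are `x k`, the
labels `y k`, the noise level is `s`, the learning rate is `e`, and the minibatch is `z`. -/
noncomputable def sgdStep {n N b : ℕ} (x : Fin N → EuclideanSpace ℝ (Fin n)) (y : Fin N → ℝ)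
    (s e : ℝ) (w : EuclideanSpace ℝ (Fin n))
    (z : (Fin b → Fin N) × (Fin b → EuclideanSpace ℝ (Fin n))) : EuclideanSpace ℝ (Fin n) :=
  w + (2 * e / b) • ∑ j, (y (z.1 j) - inner ℝ w (x (z.1 j) + s • z.2 j)) •
    (x (z.1 j) + s • z.2 j)

theorem measurable_sgdStep {n N b : ℕ} (x : Fin N → EuclideanSpace ℝ (Fin n)) (y : Fin N → ℝ)
    (s e : ℝ) : Measurable fun q : EuclideanSpace ℝ (Fin n) ×
      ((Fin b → Fin N) × (Fin b → EuclideanSpace ℝ (Fin n))) => sgdStep x y s e q.1 q.2 := by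
  have hx : Measurable x := measurable_of_finite x
  have hy : Measurable y := measurable_of_finite y
  unfold sgdStep
  fun_prop

/-- Cauchy–Schwarz over the batch. The quadratic part of a step only has to be of order `e ^ 2`
uniformly in `b`, so independence within the batch is not needed. -/
theorem norm_map_sum_sq_le {E F : Type*} [NormedAddCommGroup E] [InnerProductSpace ℝ E]
    [NormedAddCommGroup F] [InnerProductSpace ℝ F] {b : ℕ} (hb : 0 < b)
    (Q : E →L[ℝ] F) (e : ℝ) (r : Fin b → ℝ) (ξ : Fin b → E) :
    ‖Q ((2 * e / b) • ∑ j, r j • ξ j)‖ ^ 2 ≤ 4 * e ^ 2 / b * ∑ j, r j ^ 2 * ‖Q (ξ j)‖ ^ 2 := by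
  have hb' : (0 : ℝ) < b := by exact_mod_cast hb
  have h1 : ‖∑ j, r j • Q (ξ j)‖ ^ 2 ≤ b * ∑ j, r j ^ 2 * ‖Q (ξ j)‖ ^ 2 := by
    calc ‖∑ j, r j • Q (ξ j)‖ ^ 2 ≤ (∑ j, ‖r j • Q (ξ j)‖) ^ 2 := by
          gcongr; exact norm_sum_le _ _
      _ ≤ b * ∑ j, ‖r j • Q (ξ j)‖ ^ 2 := by
          simpa using sq_sum_le_card_mul_sum_sq (s := (Finset.univ : Finset (Fin b)))
            (f := fun j => ‖r j • Q (ξ j)‖)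
      _ = _ := by simp [norm_smul, mul_pow]
  rw [map_smul, map_sum, norm_smul, mul_pow]
  simp only [map_smul]
  calc _ ≤ ‖2 * e / (b : ℝ)‖ ^ 2 * (b * ∑ j, r j ^ 2 * ‖Q (ξ j)‖ ^ 2) := by gcongr
    _ = _ := by
      rw [Real.norm_eq_abs, sq_abs]; field_simp; ring

/-- The projection is self-adjoint and idempotent, so in the cross term it can be removed from the
increment `d`. The drift is then tested against the fixed vector `U.starProjection v`. -/
theorem norm_starProjection_add_sq {E : Type*} [NormedAddCommGroup E] [InnerProductSpace ℝ E]
    (U : Submodule ℝ E) [U.HasOrthogonalProjection] (v d : E) :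
    ‖U.starProjection (v + d)‖ ^ 2 = ‖U.starProjection v‖ ^ 2 +
      2 * inner ℝ (U.starProjection v) d + ‖U.starProjection d‖ ^ 2 := by
  rw [map_add, norm_add_sq_real, ← U.inner_starProjection_left_eq_right,
    U.starProjection_eq_self_iff.2 (U.starProjection_apply_mem v)]

/-- Second moment of the error after one step from a fixed point `w`, seen through the orthogonal
projection onto `U`. -/
theorem integral_norm_sq_sgdStep_le {Ω : Type*} [MeasurableSpace Ω] {μ : Measure Ω}
    [IsProbabilityMeasure μ] {n N b : ℕ} (hb : 0 < b)
    (x : Fin N → EuclideanSpace ℝ (Fin n)) (y : Fin N → ℝ) (s e : ℝ)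
    (Z : Ω → (Fin b → Fin N) × (Fin b → EuclideanSpace ℝ (Fin n)))
    (hZ : ∀ j, IsUniformGaussianPair μ (fun ω => (Z ω).1 j) (fun ω => (Z ω).2 j))
    (w w' : EuclideanSpace ℝ (Fin n)) (U : Submodule ℝ (EuclideanSpace ℝ (Fin n))) {K τ : ℝ}
    (hK : 0 ≤ K) (hτ : 0 ≤ τ)
    (hξ : ∀ k g, ‖U.starProjection (x k + s • g)‖ ^ 2 ≤ τ * (K * (1 + ‖g‖ ^ 2)))
    (hr : ∀ k g, (y k - inner ℝ w (x k + s • g)) ^ 2 ≤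
      K * (1 + ‖w - w'‖ ^ 2) * (1 + ‖g‖ ^ 2)) :
    Integrable (fun ω => ‖U.starProjection (sgdStep x y s e w (Z ω) - w')‖ ^ 2) μ ∧
    ∫ ω, ‖U.starProjection (sgdStep x y s e w (Z ω) - w')‖ ^ 2 ∂μ ≤
      ‖U.starProjection (w - w')‖ ^ 2 +
      4 * e * ((∑ k, (y k - inner ℝ w (x k)) * inner ℝ (U.starProjection (w - w')) (x k)) / N -
        s ^ 2 * inner ℝ w (U.starProjection (w - w'))) +
      4 * e ^ 2 * (τ * K ^ 2 * (1 + ‖w - w'‖ ^ 2) * gaussianMomentBound n) := by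
  have hb' : (0 : ℝ) < b := by exact_mod_cast hb
  set v := w - w' with hv
  set q := U.starProjection v with hq
  set M := τ * K ^ 2 * (1 + ‖v‖ ^ 2) with hM
  have hM0 : 0 ≤ M := by positivity
  let D : Fin b → Ω → ℝ := fun j ω =>
    (y ((Z ω).1 j) - inner ℝ w (x ((Z ω).1 j) + s • (Z ω).2 j)) *
      inner ℝ q (x ((Z ω).1 j) + s • (Z ω).2 j)
  let G : Fin b → Ω → ℝ := fun j ω => (1 + ‖(Z ω).2 j‖ ^ 2) ^ 2
  -- Pointwise majorant: the constant and linear terms in the increment are kept exactly, since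
  -- their mean carries the contraction; only the quadratic term is estimated.
  let F : Ω → ℝ := fun ω =>
    ‖q‖ ^ 2 + 4 * e / b * ∑ j, D j ω + 4 * e ^ 2 / b * ∑ j, M * G j ω
  have hFle : ∀ ω, ‖U.starProjection (sgdStep x y s e w (Z ω) - w')‖ ^ 2 ≤ F ω := by
    intro ω
    have e1 : sgdStep x y s e w (Z ω) - w' = v + (2 * e / b) • ∑ j,
        (y ((Z ω).1 j) - inner ℝ w (x ((Z ω).1 j) + s • (Z ω).2 j)) •
        (x ((Z ω).1 j) + s • (Z ω).2 j) := by
      rw [sgdStep, hv]; abel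
    rw [e1, norm_starProjection_add_sq]
    refine add_le_add (le_of_eq ?_) ?_
    · rw [inner_smul_right, inner_sum]
      simp only [inner_smul_right, D]
      ring
    · refine (norm_map_sum_sq_le hb _ _ _ _).trans ?_
      refine mul_le_mul_of_nonneg_left (Finset.sum_le_sum fun j _ => ?_) (by positivity)
      refine (mul_le_mul (hr _ _) (hξ _ _) (by positivity) (by positivity)).trans_eq ?_
      simp only [G, hM]
      ring
  have hD : ∀ j, Integrable (D j) μ := fun j =>
    ((hZ j).hasIntegral_residual_mul_inner x y s w q).1
  have hG : ∀ j, Integrable (fun ω => M * G j ω) μ := fun j =>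
    (hZ j).integrable_one_add_norm_sq_sq.const_mul M
  have i1 : Integrable (fun ω => 4 * e / b * ∑ j, D j ω) μ :=
    (integrable_finsetSum _ fun j _ => hD j).const_mul _
  have i2 : Integrable (fun ω => 4 * e ^ 2 / b * ∑ j, M * G j ω) μ :=
    (integrable_finsetSum _ fun j _ => hG j).const_mul _
  have i01 : Integrable (fun ω => ‖q‖ ^ 2 + 4 * e / b * ∑ j, D j ω) μ :=
    (integrable_const _).add i1
  have hF : Integrable F μ := i01.add i2
  have hZm : Measurable Z := by
    refine Measurable.prodMk ?_ ?_
    · exact measurable_pi_lambda _ fun j => (hZ j).measurable_fst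
    · exact measurable_pi_lambda _ fun j => (hZ j).measurable_snd
  have hmeas : Measurable fun ω => ‖U.starProjection (sgdStep x y s e w (Z ω) - w')‖ ^ 2 := by
    have h1 : Measurable fun ω => sgdStep x y s e w (Z ω) :=
      (measurable_sgdStep x y s e).comp (measurable_const.prodMk hZm)
    fun_prop
  have hint : Integrable (fun ω => ‖U.starProjection (sgdStep x y s e w (Z ω) - w')‖ ^ 2) μ :=
    hF.mono' hmeas.aestronglyMeasurable (ae_of_all _ fun ω => by
      rw [Real.norm_of_nonneg (by positivity)]; exact hFle ω)
  refine ⟨hint, (integral_mono hint hF hFle).trans ?_⟩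
  simp only [F]
  rw [integral_add i01 i2, integral_add (integrable_const _) i1, integral_const_mul,
    integral_const_mul, integral_finsetSum _ fun j _ => hD j, integral_finsetSum _ fun j _ => hG j]
  have e2 : ∀ j, ∫ ω, D j ω ∂μ = (∑ k, (y k - inner ℝ w (x k)) * inner ℝ q (x k)) / N -
      s ^ 2 * inner ℝ w q := fun j => ((hZ j).hasIntegral_residual_mul_inner x y s w q).2
  have e3 : ∑ j, ∫ ω, M * G j ω ∂μ ≤ b * (M * gaussianMomentBound n) := by
    calc _ ≤ ∑ _j : Fin b, M * gaussianMomentBound n := by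
          refine Finset.sum_le_sum fun j _ => ?_
          rw [integral_const_mul]
          exact mul_le_mul_of_nonneg_left (hZ j).integral_one_add_norm_sq_sq_le hM0
      _ = _ := by simp
  simp only [e2, integral_const, probReal_univ, Finset.sum_const, Finset.card_univ,
    Fintype.card_fin, nsmul_eq_mul, one_smul]
  refine add_le_add (le_of_eq ?_) ?_
  · field_simp
  · refine (mul_le_mul_of_nonneg_left e3 (by positivity)).trans_eq ?_
    field_simp

/-! ### From one step to a recursion for second moments -/

/-- Freezing lemma: a bound for the integral over one of two independent variables, uniform in the
other, integrates. -/
theorem ProbabilityTheory.IndepFun.integral_comp_le {Ω α β : Type*} [MeasurableSpace Ω]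
    [MeasurableSpace α] [MeasurableSpace β] {μ : Measure Ω} [IsProbabilityMeasure μ]
    {V : Ω → α} {Z : Ω → β} (hV : Measurable V) (hZ : Measurable Z) (hind : IndepFun V Z μ)
    {f : α × β → ℝ} (hf : Measurable f) (hf0 : ∀ q, 0 ≤ f q) {φ : α → ℝ} (hφ : Measurable φ)
    (hφi : Integrable (fun ω => φ (V ω)) μ)
    (hle : ∀ w, Integrable (fun ω => f (w, Z ω)) μ ∧ ∫ ω, f (w, Z ω) ∂μ ≤ φ w) :
    Integrable (fun ω => f (V ω, Z ω)) μ ∧ ∫ ω, f (V ω, Z ω) ∂μ ≤ ∫ ω, φ (V ω) ∂μ := by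
  have hmap := (indepFun_iff_map_prod_eq_prod_map_map hV.aemeasurable hZ.aemeasurable).1 hind
  have : IsProbabilityMeasure (μ.map V) := Measure.isProbabilityMeasure_map hV.aemeasurable
  have : IsProbabilityMeasure (μ.map Z) := Measure.isProbabilityMeasure_map hZ.aemeasurable
  have hφi' : Integrable φ (μ.map V) :=
    (integrable_map_measure hφ.aestronglyMeasurable hV.aemeasurable).2 hφi
  have hsec : ∀ w, Integrable (fun z => f (w, z)) (μ.map Z) ∧
      ∫ z, f (w, z) ∂(μ.map Z) ≤ φ w := by
    intro w
    have hm : AEStronglyMeasurable (fun z => f (w, z)) (μ.map Z) :=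
      (hf.comp measurable_prodMk_left).aestronglyMeasurable
    refine ⟨(integrable_map_measure hm hZ.aemeasurable).2 (hle w).1, ?_⟩
    rw [integral_map hZ.aemeasurable hm]
    exact (hle w).2
  have hinner : Integrable (fun w => ∫ z, f (w, z) ∂(μ.map Z)) (μ.map V) := by
    refine hφi'.mono' hf.stronglyMeasurable.integral_prod_right'.aestronglyMeasurable
      (ae_of_all _ fun w => ?_)
    rw [Real.norm_of_nonneg (integral_nonneg fun z => hf0 _)]
    exact (hsec w).2
  -- As `f` is nonnegative, integrable sections and an integrable inner integral give integrability
  -- on the product.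
  have hprod : Integrable f ((μ.map V).prod (μ.map Z)) := by
    rw [integrable_prod_iff hf.aestronglyMeasurable]
    refine ⟨ae_of_all _ fun w => (hsec w).1, ?_⟩
    simpa only [Real.norm_of_nonneg (hf0 _)] using hinner
  have hprod' := hprod
  rw [← hmap] at hprod'
  refine ⟨hprod'.comp_measurable (hV.prodMk hZ), ?_⟩
  calc ∫ ω, f (V ω, Z ω) ∂μ = ∫ q, f q ∂(μ.map fun ω => (V ω, Z ω)) :=
        (integral_map (hV.prodMk hZ).aemeasurable hf.aestronglyMeasurable).symm
    _ = ∫ w, ∫ z, f (w, z) ∂(μ.map Z) ∂(μ.map V) := by rw [hmap, integral_prod _ hprod]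
    _ ≤ ∫ w, φ w ∂(μ.map V) := integral_mono hinner hφi' fun w => (hsec w).2
    _ = _ := integral_map hV.aemeasurable hφ.aestronglyMeasurable

/-- On the span of finitely many vectors, the associated quadratic form is coercive. -/
theorem exists_pos_mul_norm_sq_le_sum_inner_sq {n N : ℕ} (hN : 0 < N)
    (x : Fin N → EuclideanSpace ℝ (Fin n)) :
    ∃ l > 0, ∀ v ∈ Submodule.span ℝ (Set.range x), l * ‖v‖ ^ 2 ≤ (∑ k, inner ℝ v (x k) ^ 2) / N := by
  set S := Submodule.span ℝ (Set.range x)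
  let T : EuclideanSpace ℝ (Fin n) →ₗ[ℝ] EuclideanSpace ℝ (Fin N) :=
    { toFun := fun v => WithLp.toLp 2 fun k => inner ℝ v (x k)
      map_add' := fun u v => by ext k; simp [inner_add_left]
      map_smul' := fun c v => by ext k; simp [inner_smul_left] }
  -- A vector of the span orthogonal to every `x k` is orthogonal to itself. In finite dimension
  -- injectivity then gives a lower bound for `T` on `S`.
  have hker : (T ∘ₗ S.subtype).ker = ⊥ := by
    rw [LinearMap.ker_eq_bot']
    rintro ⟨v, hv⟩ h0
    have h1 : ∀ k, inner ℝ v (x k) = 0 := fun k => congrArg (fun f => f k) h0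
    have h2 : v ∈ Sᗮ := by
      rw [Submodule.mem_orthogonal']
      intro u hu
      induction hu using Submodule.span_induction with
      | mem u hu => obtain ⟨k, rfl⟩ := hu; exact h1 k
      | zero => simp
      | add a b _ _ ha hb => simp [inner_add_right, ha, hb]
      | smul c a _ ha => simp [inner_smul_right, ha]
    have h3 : inner ℝ v v = 0 := Submodule.inner_right_of_mem_orthogonal hv h2
    exact Subtype.ext (inner_self_eq_zero.1 h3)
  obtain ⟨C, hC, hT⟩ := LinearMap.exists_antilipschitzWith _ hker
  have hC' : (0 : ℝ) < C := by exact_mod_cast hC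
  have hN' : (0 : ℝ) < N := by exact_mod_cast hN
  refine ⟨1 / (C ^ 2 * N), by positivity, fun v hv => ?_⟩
  have h4 : ‖v‖ ≤ C * ‖T v‖ := by
    simpa using hT.le_mul_norm_sub (⟨v, hv⟩ : S) 0
  have h5 : ‖T v‖ ^ 2 = ∑ k, inner ℝ v (x k) ^ 2 := by simp [EuclideanSpace.norm_sq_eq, T]
  have h6 : ‖v‖ ^ 2 ≤ C ^ 2 * ∑ k, inner ℝ v (x k) ^ 2 := by
    rw [← h5, ← mul_pow]; gcongr
  rw [div_mul_eq_mul_div, one_mul, div_le_div_iff₀ (by positivity) hN']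
  nlinarith

/-- Bounds for noisy data points and residuals in terms of the noise. -/
theorem exists_bound_noisy_data {n N : ℕ} (x : Fin N → EuclideanSpace ℝ (Fin n)) (y : Fin N → ℝ)
    (w' : EuclideanSpace ℝ (Fin n)) (s₀ : ℝ) :
    ∃ K, 1 ≤ K ∧ ∀ s : ℝ, s ^ 2 ≤ s₀ → ∀ k g, ‖x k + s • g‖ ^ 2 ≤ K * (1 + ‖g‖ ^ 2) ∧
      ∀ w, (y k - inner ℝ w (x k + s • g)) ^ 2 ≤ K * (1 + ‖w - w'‖ ^ 2) * (1 + ‖g‖ ^ 2) := by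
  set D := ∑ k, ‖x k‖ ^ 2
  set Y := ∑ k, y k ^ 2
  have hD : ∀ k, ‖x k‖ ^ 2 ≤ D := fun k =>
    Finset.single_le_sum (f := fun k => ‖x k‖ ^ 2) (fun _ _ => by positivity) (Finset.mem_univ k)
  have hY : ∀ k, y k ^ 2 ≤ Y := fun k =>
    Finset.single_le_sum (f := fun k => y k ^ 2) (fun _ _ => by positivity) (Finset.mem_univ k)
  have hD0 : 0 ≤ D := Finset.sum_nonneg fun _ _ => by positivity
  have hY0 : 0 ≤ Y := Finset.sum_nonneg fun _ _ => by positivity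
  set K₁ := 1 + 2 * D + 2 * |s₀|
  have hK₁ : 1 ≤ K₁ := by have := abs_nonneg s₀; simp only [K₁]; linarith
  -- The residual is split into the label, the prediction of `w'` and that of `w - w'`, whence the
  -- factors 3; `K₁` alone controls the noisy data point.
  refine ⟨K₁ + 3 * Y + 3 * K₁ * (‖w'‖ ^ 2 + 1), ?_, fun s hs k g => ?_⟩
  · have : 0 ≤ 3 * K₁ * (‖w'‖ ^ 2 + 1) := by positivity
    linarith
  have h1 : ‖x k + s • g‖ ^ 2 ≤ K₁ * (1 + ‖g‖ ^ 2) := by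
    have h2 : ‖x k + s • g‖ ^ 2 ≤ 2 * ‖x k‖ ^ 2 + 2 * (s ^ 2 * ‖g‖ ^ 2) := by
      have h3 := norm_add_le (x k) (s • g)
      have h4 : ‖s • g‖ ^ 2 = s ^ 2 * ‖g‖ ^ 2 := by rw [norm_smul, mul_pow, Real.norm_eq_abs, sq_abs]
      rw [← h4]
      nlinarith [sq_nonneg (‖x k‖ - ‖s • g‖), norm_nonneg (x k + s • g)]
    have h5 : s ^ 2 * ‖g‖ ^ 2 ≤ |s₀| * ‖g‖ ^ 2 := by
      gcongr; exact hs.trans (le_abs_self _)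
    have h6 : 0 ≤ D * ‖g‖ ^ 2 := by positivity
    have h7 := hD k
    have h8 := abs_nonneg s₀
    have h9 := sq_nonneg ‖g‖
    simp only [K₁]
    nlinarith
  refine ⟨h1.trans ?_, fun w => ?_⟩
  · gcongr
    have : 0 ≤ 3 * K₁ * (‖w'‖ ^ 2 + 1) := by positivity
    linarith
  · set ξ := x k + s • g
    set v := w - w' with hv
    have e1 : inner ℝ w ξ = inner ℝ w' ξ + inner ℝ v ξ := by
      rw [hv, inner_sub_left]; ring
    have h2 : (y k - inner ℝ w ξ) ^ 2 ≤ 3 * y k ^ 2 + 3 * (inner ℝ w' ξ) ^ 2 + 3 * (inner ℝ v ξ) ^ 2 := by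
      rw [e1]
      nlinarith [sq_nonneg (y k + inner ℝ w' ξ), sq_nonneg (y k + inner ℝ v ξ),
        sq_nonneg (inner ℝ w' ξ - inner ℝ v ξ)]
    have h3 : ∀ q : EuclideanSpace ℝ (Fin n), (inner ℝ q ξ) ^ 2 ≤ ‖q‖ ^ 2 * (K₁ * (1 + ‖g‖ ^ 2)) := by
      intro q
      calc (inner ℝ q ξ) ^ 2 = |inner ℝ q ξ| ^ 2 := (sq_abs _).symm
        _ ≤ (‖q‖ * ‖ξ‖) ^ 2 := by gcongr; exact abs_real_inner_le_norm q ξ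
        _ = ‖q‖ ^ 2 * ‖ξ‖ ^ 2 := mul_pow _ _ _
        _ ≤ _ := by gcongr
    set a := 1 + ‖g‖ ^ 2 with ha
    have ha1 : 1 ≤ a := by simp [ha]
    calc (y k - inner ℝ w ξ) ^ 2 ≤ 3 * Y + 3 * (‖w'‖ ^ 2 * (K₁ * a)) + 3 * (‖v‖ ^ 2 * (K₁ * a)) := by
          linarith [h3 w', h3 v, hY k]
      _ ≤ 3 * Y * (1 + ‖v‖ ^ 2) * a + 3 * (K₁ * (‖w'‖ ^ 2 + 1)) * (1 + ‖v‖ ^ 2) * a := by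
          have t1 : 3 * Y ≤ 3 * Y * (1 + ‖v‖ ^ 2) * a := by
            rw [mul_assoc]
            refine le_mul_of_one_le_right (by positivity) ?_
            exact one_le_mul_of_one_le_of_one_le (by nlinarith [sq_nonneg ‖v‖]) ha1
          have t2 : 0 ≤ K₁ * a := by positivity
          have t3 : 0 ≤ K₁ * a * (‖w'‖ ^ 2 * ‖v‖ ^ 2) := by positivity
          nlinarith
      _ ≤ _ := by
          have t4 : 0 ≤ K₁ * (1 + ‖v‖ ^ 2) * a := by positivity
          linarith

theorem integral_const_add_mul_add_mul {Ω : Type*} [MeasurableSpace Ω] {μ : Measure Ω}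
    [IsProbabilityMeasure μ] {f h : Ω → ℝ} (hf : Integrable f μ) (hh : Integrable h μ)
    (c d e : ℝ) : Integrable (fun ω => c * f ω + d * h ω + e) μ ∧
      ∫ ω, (c * f ω + d * h ω + e) ∂μ = c * ∫ ω, f ω ∂μ + d * ∫ ω, h ω ∂μ + e := by
  have h1 : Integrable (fun ω => c * f ω + d * h ω) μ := (hf.const_mul c).add (hh.const_mul d)
  refine ⟨h1.add (integrable_const e), ?_⟩
  rw [integral_add h1 (integrable_const e), integral_add (hf.const_mul c) (hh.const_mul d),
    integral_const_mul, integral_const_mul]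
  simp

/-- Recursive bounds for the second moments of the components of the error in the span of the data
and in its orthogonal complement. -/
theorem exists_moment_recursion {Ω : Type*} [MeasurableSpace Ω] {μ : Measure Ω}
    [IsProbabilityMeasure μ] {n N : ℕ} (hN : 0 < N) {B : ℕ → ℕ} (hB : ∀ t, 0 < B t)
    (x : Fin N → EuclideanSpace ℝ (Fin n)) (y : Fin N → ℝ) {σ η : ℕ → ℝ} (hη : ∀ t, 0 ≤ η t)
    {s₀ : ℝ} (hσ : ∀ t, σ t ^ 2 ≤ s₀)
    (Z : (t : ℕ) → Ω → (Fin (B t) → Fin N) × (Fin (B t) → EuclideanSpace ℝ (Fin n)))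
    (hZ : ∀ t j, IsUniformGaussianPair μ (fun ω => (Z t ω).1 j) (fun ω => (Z t ω).2 j))
    (w : ℕ → Ω → EuclideanSpace ℝ (Fin n)) (w₀ : EuclideanSpace ℝ (Fin n))
    (hw₀ : ∀ ω, w 0 ω = w₀)
    (hw : ∀ t ω, w (t + 1) ω = sgdStep x y (σ t) (η t) (w t ω) (Z t ω))
    (hwm : ∀ t, Measurable (w t)) (hind : ∀ t, IndepFun (w t) (Z t) μ)
    (w' : EuclideanSpace ℝ (Fin n)) (S : Submodule ℝ (EuclideanSpace ℝ (Fin n)))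
    (hS : S = Submodule.span ℝ (Set.range x)) (hw' : w' ∈ S)
    (hnormal : ∑ k, (y k - inner ℝ w' (x k)) • x k = 0) :
    (∀ t, Integrable (fun ω => ‖S.starProjection (w t ω - w')‖ ^ 2) μ ∧
      Integrable (fun ω => ‖Sᗮ.starProjection (w t ω - w')‖ ^ 2) μ) ∧
    ∃ l C : ℝ, 0 < l ∧ 0 ≤ C ∧ ∀ t,
      ∫ ω, ‖S.starProjection (w (t + 1) ω - w')‖ ^ 2 ∂μ ≤
        (1 - 2 * l * η t) * ∫ ω, ‖S.starProjection (w t ω - w')‖ ^ 2 ∂μ +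
        C * (η t * (σ t ^ 2) ^ 2 + η t ^ 2) * (1 + ∫ ω, ‖S.starProjection (w t ω - w')‖ ^ 2 ∂μ +
          ∫ ω, ‖Sᗮ.starProjection (w t ω - w')‖ ^ 2 ∂μ) ∧
      ∫ ω, ‖Sᗮ.starProjection (w (t + 1) ω - w')‖ ^ 2 ∂μ ≤
        (1 - 4 * (η t * σ t ^ 2)) * ∫ ω, ‖Sᗮ.starProjection (w t ω - w')‖ ^ 2 ∂μ +
        C * (η t ^ 2 * σ t ^ 2) * (1 + ∫ ω, ‖S.starProjection (w t ω - w')‖ ^ 2 ∂μ +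
          ∫ ω, ‖Sᗮ.starProjection (w t ω - w')‖ ^ 2 ∂μ) := by
  obtain ⟨l, hl, hcoer⟩ := exists_pos_mul_norm_sq_le_sum_inner_sq hN x
  rw [← hS] at hcoer
  obtain ⟨K, hK1, hK⟩ := exists_bound_noisy_data x y w' s₀
  have hK0 : 0 ≤ K := zero_le_one.trans hK1
  have hxS : ∀ k, x k ∈ S := fun k => hS ▸ Submodule.subset_span ⟨k, rfl⟩
  set m := gaussianMomentBound n
  have hm : 0 ≤ m := gaussianMomentBound_nonneg n
  -- The first summand comes from the quadratic part of the step, the second from the ridge bias in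
  -- `S`.
  set C := 4 * K ^ 2 * m + 2 * ‖w'‖ ^ 2 / l with hC
  have hC0 : 0 ≤ C := by positivity
  have hZm : ∀ t, Measurable (Z t) := fun t =>
    (measurable_pi_lambda _ fun j => (hZ t j).measurable_fst).prodMk
      (measurable_pi_lambda _ fun j => (hZ t j).measurable_snd)
  have hpyth : ∀ v : EuclideanSpace ℝ (Fin n),
      ‖v‖ ^ 2 = ‖S.starProjection v‖ ^ 2 + ‖Sᗮ.starProjection v‖ ^ 2 := fun v =>
    S.norm_sq_eq_add_norm_sq_starProjection v
  have hstepS : ∀ t v,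
      Integrable (fun ω => ‖S.starProjection (sgdStep x y (σ t) (η t) v (Z t ω) - w')‖ ^ 2) μ ∧
      ∫ ω, ‖S.starProjection (sgdStep x y (σ t) (η t) v (Z t ω) - w')‖ ^ 2 ∂μ ≤
        (1 - 2 * l * η t + C * (η t * (σ t ^ 2) ^ 2 + η t ^ 2)) * ‖S.starProjection (v - w')‖ ^ 2 +
        C * (η t * (σ t ^ 2) ^ 2 + η t ^ 2) * ‖Sᗮ.starProjection (v - w')‖ ^ 2 +
        C * (η t * (σ t ^ 2) ^ 2 + η t ^ 2) := by
    intro t v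
    have h := integral_norm_sq_sgdStep_le (hB t) x y (σ t) (η t) (Z t) (hZ t) v w' S hK0
      zero_le_one (fun k g => by
        rw [one_mul]
        refine le_trans ?_ (hK (σ t) (hσ t) k g).1
        gcongr
        exact S.norm_starProjection_apply_le _)
      (fun k g => (hK (σ t) (hσ t) k g).2 v)
    refine ⟨h.1, h.2.trans ?_⟩
    have hp := hpyth (v - w')
    set q := S.starProjection (v - w') with hq
    have hqS : q ∈ S := S.starProjection_apply_mem _
    have hvx : ∀ u ∈ S, inner ℝ (v - w') u = inner ℝ q u := by
      intro u hu
      rw [hq, S.inner_starProjection_left_eq_right, S.starProjection_eq_self_iff.2 hu]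
    -- Subtracting the normal equations for `w'` turns the data drift into minus the coercive
    -- quadratic form.
    have e1 : ∑ k, (y k - inner ℝ v (x k)) * inner ℝ q (x k) = -∑ k, inner ℝ q (x k) ^ 2 := by
      have h0 : ∑ k, (y k - inner ℝ w' (x k)) * inner ℝ q (x k) = 0 := by
        have := congrArg (fun u => inner ℝ q u) hnormal
        simpa [inner_sum, inner_smul_right] using this
      rw [← sub_eq_zero, ← h0, ← sub_eq_zero, sub_neg_eq_add, ← Finset.sum_add_distrib,
        ← Finset.sum_sub_distrib]
      refine Finset.sum_eq_zero fun k _ => ?_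
      have := hvx (x k) (hxS k)
      rw [inner_sub_left] at this
      rw [sq, show inner ℝ v (x k) = inner ℝ q (x k) + inner ℝ w' (x k) by linarith]
      ring
    have e2 : inner ℝ v q = ‖q‖ ^ 2 + inner ℝ w' q := by
      have := hvx q hqS
      rw [inner_sub_left, real_inner_self_eq_norm_sq] at this
      linarith
    rw [e1, e2, neg_div, hp]
    have h1 := hcoer q hqS
    have h2 : -(‖w'‖ * ‖q‖) ≤ inner ℝ w' q := by
      have := abs_real_inner_le_norm w' q
      exact (abs_le.1 this).1
    set a := ‖q‖
    set b := ‖Sᗮ.starProjection (v - w')‖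
    set s := σ t ^ 2
    have hs : 0 ≤ s := sq_nonneg _
    have he := hη t
    -- Young's inequality: half of the coercivity absorbs the ridge bias, leaving a remainder
    -- quadratic in `s`, that is, of order `σ⁴`.
    have h3 : s * (‖w'‖ * a) ≤ l / 2 * a ^ 2 + s ^ 2 * ‖w'‖ ^ 2 / (2 * l) := by
      have : l / 2 * a ^ 2 + s ^ 2 * ‖w'‖ ^ 2 / (2 * l) - s * (‖w'‖ * a) =
          (l * a - s * ‖w'‖) ^ 2 / (2 * l) := by
        field_simp; ring
      have : 0 ≤ (l * a - s * ‖w'‖) ^ 2 / (2 * l) := by positivity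
      linarith
    have h4 : -((∑ k, inner ℝ q (x k) ^ 2) / N) - s * (a ^ 2 + inner ℝ w' q) ≤
        -(l / 2 * a ^ 2) + s ^ 2 * ‖w'‖ ^ 2 / (2 * l) := by
      have := mul_le_mul_of_nonneg_left h2 hs
      have : 0 ≤ s * a ^ 2 := by positivity
      linarith
    have h5 := mul_le_mul_of_nonneg_left h4 (show 0 ≤ 4 * η t by positivity)
    have e3 : 4 * η t * (-(l / 2 * a ^ 2) + s ^ 2 * ‖w'‖ ^ 2 / (2 * l)) =
        -(2 * l * η t) * a ^ 2 + (2 * ‖w'‖ ^ 2 / l) * (η t * s ^ 2) := by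
      field_simp; ring
    rw [e3] at h5
    have h6 : (2 * ‖w'‖ ^ 2 / l) * (η t * s ^ 2) + 4 * η t ^ 2 * (1 * K ^ 2 * (1 + (a ^ 2 + b ^ 2)) * m)
        ≤ C * (η t * s ^ 2 + η t ^ 2) * (1 + (a ^ 2 + b ^ 2)) := by
      have t1 : 0 ≤ (2 * ‖w'‖ ^ 2 / l) * (η t * s ^ 2) * (a ^ 2 + b ^ 2) := by positivity
      have t2 : 0 ≤ (2 * ‖w'‖ ^ 2 / l) * η t ^ 2 * (1 + (a ^ 2 + b ^ 2)) := by positivity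
      have t3 : 0 ≤ (4 * K ^ 2 * m) * (η t * s ^ 2) * (1 + (a ^ 2 + b ^ 2)) := by positivity
      rw [hC]
      linarith
    linarith
  have hstepP : ∀ t v,
      Integrable (fun ω => ‖Sᗮ.starProjection (sgdStep x y (σ t) (η t) v (Z t ω) - w')‖ ^ 2) μ ∧
      ∫ ω, ‖Sᗮ.starProjection (sgdStep x y (σ t) (η t) v (Z t ω) - w')‖ ^ 2 ∂μ ≤
        C * (η t ^ 2 * σ t ^ 2) * ‖S.starProjection (v - w')‖ ^ 2 +
        (1 - 4 * (η t * σ t ^ 2) + C * (η t ^ 2 * σ t ^ 2)) * ‖Sᗮ.starProjection (v - w')‖ ^ 2 +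
        C * (η t ^ 2 * σ t ^ 2) := by
    intro t v
    have hperp : ∀ u ∈ S, Sᗮ.starProjection u = 0 := fun u hu =>
      (Submodule.starProjection_apply_eq_zero_iff _).2 (by simpa using hu)
    -- Here `τ = σ t ^ 2`: the projection kills the data points, so a sample contributes only `σ t •
    -- g`.
    have h := integral_norm_sq_sgdStep_le (hB t) x y (σ t) (η t) (Z t) (hZ t) v w' Sᗮ hK0
      (sq_nonneg (σ t)) (fun k g => by
        rw [map_add, hperp _ (hxS k), zero_add, map_smul, norm_smul, mul_pow, Real.norm_eq_abs,
          sq_abs]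
        refine mul_le_mul_of_nonneg_left ?_ (sq_nonneg _)
        have h1 : ‖Sᗮ.starProjection g‖ ^ 2 ≤ ‖g‖ ^ 2 := by
          gcongr
          exact Sᗮ.norm_starProjection_apply_le _
        nlinarith [sq_nonneg ‖g‖])
      (fun k g => (hK (σ t) (hσ t) k g).2 v)
    refine ⟨h.1, h.2.trans ?_⟩
    have hp := hpyth (v - w')
    set q := Sᗮ.starProjection (v - w') with hq
    have hqS : q ∈ Sᗮ := Sᗮ.starProjection_apply_mem _
    have e1 : ∑ k, (y k - inner ℝ v (x k)) * inner ℝ q (x k) = 0 :=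
      Finset.sum_eq_zero fun k _ => by
        rw [Submodule.inner_left_of_mem_orthogonal (hxS k) hqS, mul_zero]
    -- Because `w'` lies in `S`, the ridge term has no bias in `Sᗮ`.
    have e2 : inner ℝ v q = ‖q‖ ^ 2 := by
      have h1 : inner ℝ (v - w') q = inner ℝ q q := by
        conv_rhs => rw [hq, Sᗮ.inner_starProjection_left_eq_right, Sᗮ.starProjection_eq_self_iff.2
          (Sᗮ.starProjection_apply_mem _)]
      rw [inner_sub_left, Submodule.inner_right_of_mem_orthogonal hw' hqS,
        real_inner_self_eq_norm_sq, sub_zero] at h1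
      exact h1
    rw [e1, e2, hp]
    set b := ‖q‖
    set a := ‖S.starProjection (v - w')‖
    have t2 : 0 ≤ (2 * ‖w'‖ ^ 2 / l) * (η t ^ 2 * σ t ^ 2) * (1 + (a ^ 2 + b ^ 2)) := by positivity
    rw [hC, zero_div, zero_sub]
    linarith
  have hmS : Measurable fun v : EuclideanSpace ℝ (Fin n) => ‖S.starProjection (v - w')‖ ^ 2 := by
    fun_prop
  have hmP : Measurable fun v : EuclideanSpace ℝ (Fin n) => ‖Sᗮ.starProjection (v - w')‖ ^ 2 := by
    fun_prop
  -- The bound from a frozen starting point is averaged over `w t`, which is independent of the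
  -- current minibatch.
  have hnext : ∀ (t : ℕ) (U : Submodule ℝ (EuclideanSpace ℝ (Fin n))) (c d e : ℝ),
      Integrable (fun ω => ‖S.starProjection (w t ω - w')‖ ^ 2) μ →
      Integrable (fun ω => ‖Sᗮ.starProjection (w t ω - w')‖ ^ 2) μ →
      (∀ v, Integrable (fun ω => ‖U.starProjection (sgdStep x y (σ t) (η t) v (Z t ω) - w')‖ ^ 2) μ ∧
        ∫ ω, ‖U.starProjection (sgdStep x y (σ t) (η t) v (Z t ω) - w')‖ ^ 2 ∂μ ≤
        c * ‖S.starProjection (v - w')‖ ^ 2 + d * ‖Sᗮ.starProjection (v - w')‖ ^ 2 + e) →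
      Integrable (fun ω => ‖U.starProjection (w (t + 1) ω - w')‖ ^ 2) μ ∧
        ∫ ω, ‖U.starProjection (w (t + 1) ω - w')‖ ^ 2 ∂μ ≤
        c * ∫ ω, ‖S.starProjection (w t ω - w')‖ ^ 2 ∂μ +
          d * ∫ ω, ‖Sᗮ.starProjection (w t ω - w')‖ ^ 2 ∂μ + e := by
    intro t U c d e h1 h2 h3
    have h4 := integral_const_add_mul_add_mul h1 h2 c d e
    have hmU : Measurable fun v : EuclideanSpace ℝ (Fin n) => ‖U.starProjection (v - w')‖ ^ 2 := by
      fun_prop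
    have h5 := (hind t).integral_comp_le (hwm t) (hZm t)
      (f := fun q => ‖U.starProjection (sgdStep x y (σ t) (η t) q.1 q.2 - w')‖ ^ 2)
      (hmU.comp (measurable_sgdStep x y (σ t) (η t))) (fun q => sq_nonneg _)
      (φ := fun v => c * ‖S.starProjection (v - w')‖ ^ 2 +
        d * ‖Sᗮ.starProjection (v - w')‖ ^ 2 + e)
      (((hmS.const_mul c).add (hmP.const_mul d)).add_const e) h4.1 h3
    simp only [hw]
    exact ⟨h5.1, h5.2.trans_eq h4.2⟩
  have hint : ∀ t, Integrable (fun ω => ‖S.starProjection (w t ω - w')‖ ^ 2) μ ∧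
      Integrable (fun ω => ‖Sᗮ.starProjection (w t ω - w')‖ ^ 2) μ := by
    intro t
    induction t with
    | zero => simp only [hw₀]; exact ⟨integrable_const _, integrable_const _⟩
    | succ t ih =>
      exact ⟨(hnext t S _ _ _ ih.1 ih.2 (hstepS t)).1, (hnext t Sᗮ _ _ _ ih.1 ih.2 (hstepP t)).1⟩
  refine ⟨hint, l, C, hl, hC0, fun t => ⟨?_, ?_⟩⟩
  · exact (hnext t S _ _ _ (hint t).1 (hint t).2 (hstepS t)).2.trans_eq (by ring)
  · exact (hnext t Sᗮ _ _ _ (hint t).1 (hint t).2 (hstepP t)).2.trans_eq (by ring)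

/-! ### Convergence and rate for the second moments -/

/-- The coupled recursion for the two second moments is bounded and tends to zero. -/
theorem tendsto_zero_of_moment_recursion {a u η s : ℕ → ℝ} {l C s₀ : ℝ} (hl : 0 < l) (hC : 0 ≤ C)
    (ha0 : ∀ t, 0 ≤ a t) (hu0 : ∀ t, 0 ≤ u t) (hη0 : ∀ t, 0 ≤ η t)
    (hη : Tendsto η atTop (𝓝 0)) (hs0 : ∀ t, 0 ≤ s t) (hs1 : ∀ t, s t ≤ s₀)
    (hs : Tendsto s atTop (𝓝 0))
    (hdiv : Tendsto (fun T : ℕ => ∑ t ∈ Finset.range T, η t * s t) atTop atTop)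
    (ha : ∀ t, a (t + 1) ≤ (1 - 2 * l * η t) * a t +
      C * (η t * s t ^ 2 + η t ^ 2) * (1 + a t + u t))
    (hu : ∀ t, u (t + 1) ≤ (1 - 4 * (η t * s t)) * u t +
      C * (η t ^ 2 * s t) * (1 + a t + u t)) :
    (∃ A, 1 ≤ A ∧ ∀ᶠ t in atTop, a t ≤ A ∧ u t ≤ A) ∧
      Tendsto a atTop (𝓝 0) ∧ Tendsto u atTop (𝓝 0) := by
  have hα0 : ∀ t, 0 ≤ 2 * l * η t := fun t => mul_nonneg (by positivity) (hη0 t)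
  have hβ0 : ∀ t, 0 ≤ 4 * (η t * s t) := fun t =>
    mul_nonneg (by norm_num) (mul_nonneg (hη0 t) (hs0 t))
  have hα1 : ∀ᶠ t in atTop, 2 * l * η t ≤ 1 := by
    have : Tendsto (fun t => 2 * l * η t) atTop (𝓝 0) := by simpa using hη.const_mul (2 * l)
    exact this.eventually_le_const one_pos
  have hβ1 : ∀ᶠ t in atTop, 4 * (η t * s t) ≤ 1 := by
    have : Tendsto (fun t => 4 * (η t * s t)) atTop (𝓝 0) := by
      simpa using (hη.mul hs).const_mul 4
    exact this.eventually_le_const one_pos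
  -- Forcing divided by contraction rate, in `S` and then in `Sᗮ`.
  have hδ : Tendsto (fun t => C / (2 * l) * (s t ^ 2 + η t)) atTop (𝓝 0) := by
    simpa using ((hs.pow 2).add hη).const_mul (C / (2 * l))
  have hδ' : Tendsto (fun t => C / 4 * η t) atTop (𝓝 0) := by
    simpa using hη.const_mul (C / 4)
  have ha' : ∀ t, a (t + 1) ≤ (1 - 2 * l * η t) * a t +
      2 * l * η t * (C / (2 * l) * (s t ^ 2 + η t) * (1 + a t + u t)) := fun t =>
    (ha t).trans_eq (by field_simp)
  have hu' : ∀ t, u (t + 1) ≤ (1 - 4 * (η t * s t)) * u t +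
      4 * (η t * s t) * (C / 4 * η t * (1 + a t + u t)) := fun t =>
    (hu t).trans_eq (by ring)
  obtain ⟨A, hA1, hA⟩ := exists_bound_of_coupled_convex_comb ha0 hu0 hα0 hα1 hβ0 hβ1 hδ hδ' ha' hu'
  have hdivβ : Tendsto (fun T : ℕ => ∑ t ∈ Finset.range T, 4 * (η t * s t)) atTop atTop := by
    simp only [← Finset.mul_sum]
    exact hdiv.const_mul_atTop (by norm_num)
  have hs₀ : 0 ≤ s₀ := (hs0 0).trans (hs1 0)
  -- Since `s` is bounded, divergence of `∑ η * s` forces that of `∑ η`; `s₀ + 1` avoids dividing by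
  -- zero.
  have hdivα : Tendsto (fun T : ℕ => ∑ t ∈ Finset.range T, 2 * l * η t) atTop atTop := by
    refine tendsto_atTop_mono (fun T => Finset.sum_le_sum fun t _ => ?_)
      (f := fun T : ℕ => ∑ t ∈ Finset.range T, 2 * l / (s₀ + 1) * (η t * s t)) ?_
    · rw [div_mul_eq_mul_div, div_le_iff₀ (by positivity), mul_assoc, mul_assoc, mul_assoc]
      have := hη0 t
      gcongr
      linarith [hs1 t]
    · simp only [← Finset.mul_sum]
      exact hdiv.const_mul_atTop (by positivity)
  refine ⟨⟨A, hA1, hA⟩, ?_, ?_⟩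
  · refine tendsto_zero_of_le_convex_comb ha0 hα0 hα1 hdivα
      (δ := fun t => C / (2 * l) * (s t ^ 2 + η t) * (3 * A)) (by simpa using hδ.mul_const (3 * A)) ?_
    filter_upwards [hA] with t ht
    refine (ha' t).trans ?_
    have h1 := hα0 t
    have h2 := hη0 t
    gcongr
    linarith
  · refine tendsto_zero_of_le_convex_comb hu0 hβ0 hβ1 hdivβ
      (δ := fun t => C / 4 * η t * (3 * A)) (by simpa using hδ'.mul_const (3 * A)) ?_
    filter_upwards [hA] with t ht
    refine (hu' t).trans ?_
    have h1 := hβ0 t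
    have h2 := hη0 t
    gcongr
    linarith

theorem Asymptotics.IsTheta.exists_rpow_bounds {f : ℕ → ℝ} (hf : ∀ t, 0 ≤ f t) {r : ℝ}
    (h : f =Θ[atTop] fun t : ℕ => (t : ℝ) ^ r) :
    ∃ c C : ℝ, 0 < c ∧ 0 < C ∧ ∀ᶠ t : ℕ in atTop, c * (t : ℝ) ^ r ≤ f t ∧ f t ≤ C * (t : ℝ) ^ r := by
  obtain ⟨C, hC, h1⟩ := h.1.exists_pos
  obtain ⟨c, hc, h2⟩ := h.2.exists_pos
  refine ⟨c⁻¹, C, inv_pos.2 hc, hC, ?_⟩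
  filter_upwards [h1.bound, h2.bound] with t ht1 ht2
  have h3 : 0 ≤ (t : ℝ) ^ r := by positivity
  rw [Real.norm_of_nonneg (hf t), Real.norm_of_nonneg h3] at ht1 ht2
  exact ⟨by rwa [inv_mul_le_iff₀ hc], ht1⟩

/-- Polynomial decay of the two second moments for polynomially decaying parameters. -/
theorem exists_rate_of_moment_recursion {a u η s : ℕ → ℝ} {l C A x y : ℝ} (hl : 0 < l) (hC : 0 ≤ C)
    (hA : 1 ≤ A) (ha0 : ∀ t, 0 ≤ a t) (hu0 : ∀ t, 0 ≤ u t)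
    (hη0 : ∀ t, 0 ≤ η t) (hs0 : ∀ t, 0 ≤ s t)
    (hx : 0 < x) (hy : 0 < y) (hxy : x + y < 1)
    (hη : η =Θ[atTop] fun t : ℕ => (t : ℝ) ^ (-x)) (hs : s =Θ[atTop] fun t : ℕ => (t : ℝ) ^ (-y))
    (hbd : ∀ᶠ t in atTop, a t ≤ A ∧ u t ≤ A)
    (ha : ∀ t, a (t + 1) ≤ (1 - 2 * l * η t) * a t +
      C * (η t * s t ^ 2 + η t ^ 2) * (1 + a t + u t))
    (hu : ∀ t, u (t + 1) ≤ (1 - 4 * (η t * s t)) * u t +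
      C * (η t ^ 2 * s t) * (1 + a t + u t)) :
    ∃ D, ∀ᶠ t : ℕ in atTop, a t + u t ≤ D * (t : ℝ) ^ (-(2 * min y (x / 2))) := by
  obtain ⟨c₁, C₁, hc₁, hC₁, h1⟩ := hη.exists_rpow_bounds hη0
  obtain ⟨c₂, C₂, hc₂, hC₂, h2⟩ := hs.exists_rpow_bounds hs0
  -- The slower of `σ⁴`, of order `t ^ (-(2 * y))`, and `η`, of order `t ^ (-x)`.
  set r := 2 * min y (x / 2) with hr
  have hr0 : 0 ≤ r := by positivity
  have hry : r ≤ 2 * y := by rw [hr]; linarith [min_le_left y (x / 2)]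
  have hrx : r ≤ x := by rw [hr]; linarith [min_le_right y (x / 2)]
  obtain ⟨D₁, hD₁, hd₁⟩ := exists_le_rpow_of_recursion (z := a) (c := 2 * l * c₁)
    (K := C * (C₁ * C₂ ^ 2 + C₁ ^ 2) * (3 * A)) (q := x) (r := r)
    (by positivity) (by positivity) hx (by linarith) hr0 (by
      filter_upwards [h1, h2, hbd, eventually_ge_atTop 1] with t ht1 ht2 ht3 ht
      have htp : (1 : ℝ) ≤ t := by exact_mod_cast ht
      have ht0 : (0 : ℝ) < t := by linarith
      refine (ha t).trans (add_le_add ?_ ?_)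
      · refine mul_le_mul_of_nonneg_right ?_ (ha0 t)
        have := mul_le_mul_of_nonneg_left ht1.1 (show 0 ≤ 2 * l by positivity)
        linarith
      · have e1 : s t ^ 2 ≤ C₂ ^ 2 * (t : ℝ) ^ (-r) := by
          calc s t ^ 2 ≤ (C₂ * (t : ℝ) ^ (-y)) ^ 2 := by
                have := hs0 t
                gcongr
                exact ht2.2
            _ = C₂ ^ 2 * (t : ℝ) ^ (-(2 * y)) := by
                rw [mul_pow, ← Real.rpow_natCast ((t : ℝ) ^ (-y)), ← Real.rpow_mul ht0.le]
                congr 2; push_cast; ring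
            _ ≤ _ := by gcongr 2; linarith
        have e2 : η t ≤ C₁ * (t : ℝ) ^ (-r) := by
          refine ht1.2.trans ?_
          gcongr 2; linarith
        have e3 : η t * s t ^ 2 + η t ^ 2 ≤
            (C₁ * C₂ ^ 2 + C₁ ^ 2) * ((t : ℝ) ^ (-x) * (t : ℝ) ^ (-r)) := by
          calc η t * s t ^ 2 + η t ^ 2 = η t * (s t ^ 2 + η t) := by ring
            _ ≤ (C₁ * (t : ℝ) ^ (-x)) * (C₂ ^ 2 * (t : ℝ) ^ (-r) + C₁ * (t : ℝ) ^ (-r)) :=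
                mul_le_mul ht1.2 (add_le_add e1 e2) (by have := hη0 t; positivity) (by positivity)
            _ = _ := by ring
        calc _ ≤ C * ((C₁ * C₂ ^ 2 + C₁ ^ 2) * ((t : ℝ) ^ (-x) * (t : ℝ) ^ (-r))) * (3 * A) := by
              have := ha0 t
              have := hu0 t
              gcongr
              linarith
          _ = _ := by ring)
  -- In `Sᗮ` the contraction rate has order `t ^ (-(x + y))`, so `x + y < 1` is what the recursion
  -- lemma requires.
  obtain ⟨D₂, hD₂, hd₂⟩ := exists_le_rpow_of_recursion (z := u) (c := 4 * (c₁ * c₂))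
    (K := C * (C₁ ^ 2 * C₂) * (3 * A)) (q := x + y) (r := r)
    (by positivity) (by positivity) (by positivity) hxy hr0 (by
      filter_upwards [h1, h2, hbd, eventually_ge_atTop 1] with t ht1 ht2 ht3 ht
      have htp : (1 : ℝ) ≤ t := by exact_mod_cast ht
      have ht0 : (0 : ℝ) < t := by linarith
      have e0 : (t : ℝ) ^ (-(x + y)) = (t : ℝ) ^ (-x) * (t : ℝ) ^ (-y) := by
        rw [← Real.rpow_add ht0]; congr 1; ring
      rw [e0]
      refine (hu t).trans (add_le_add ?_ ?_)
      · refine mul_le_mul_of_nonneg_right ?_ (hu0 t)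
        have := mul_le_mul ht1.1 ht2.1 (by positivity) (hη0 t)
        linarith
      · have e2 : η t ≤ C₁ * (t : ℝ) ^ (-r) := by
          refine ht1.2.trans ?_
          gcongr 2; linarith
        have e3 : η t ^ 2 * s t ≤
            (C₁ ^ 2 * C₂) * ((t : ℝ) ^ (-x) * (t : ℝ) ^ (-y) * (t : ℝ) ^ (-r)) := by
          calc η t ^ 2 * s t = η t * η t * s t := by ring
            _ ≤ (C₁ * (t : ℝ) ^ (-x)) * (C₁ * (t : ℝ) ^ (-r)) * (C₂ * (t : ℝ) ^ (-y)) :=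
                mul_le_mul (mul_le_mul ht1.2 e2 (hη0 t) (by positivity)) ht2.2 (hs0 t)
                  (by positivity)
            _ = _ := by ring
        calc _ ≤ C * ((C₁ ^ 2 * C₂) * ((t : ℝ) ^ (-x) * (t : ℝ) ^ (-y) * (t : ℝ) ^ (-r))) *
              (3 * A) := by
              have := ha0 t
              have := hu0 t
              gcongr
              linarith
          _ = _ := by ring)
  refine ⟨D₁ + D₂, ?_⟩
  filter_upwards [hd₁, hd₂] with t ht1 ht2
  linarith

/-! ### The minimum norm solution, and Chebyshev's inequality -/

/-- The minimum norm solution satisfies the normal equations. -/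
theorem minNormSol_mul_mul_transpose {n p N : ℕ} (X : Matrix (Fin n) (Fin N) ℝ)
    (Y : Matrix (Fin p) (Fin N) ℝ) : minNormSol X Y * X * Xᵀ = Y * Xᵀ := by
  have hP := isMoorePenrose_pinv (X * Xᵀ)
  set M := X * Xᵀ with hM
  set R := Xᵀ * (pinv M * M - 1) with hR
  -- The Gram matrix of `R` contains the factor `M * (pinv M * M - 1)`, which vanishes by the first
  -- Penrose equation.
  have h1 : Rᴴ * R = 0 := by
    have : M * (pinv M * M - 1) = 0 := by
      rw [Matrix.mul_sub, Matrix.mul_one, ← Matrix.mul_assoc, hP.mul_mul_self, sub_self]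
    rw [hR, Matrix.conjTranspose_eq_transpose_of_trivial, Matrix.transpose_mul,
      Matrix.transpose_transpose, Matrix.mul_assoc, ← Matrix.mul_assoc X, ← hM, this,
      Matrix.mul_zero]
  have h2 : Xᵀ * (pinv M * M) = Xᵀ := by
    have := Matrix.conjTranspose_mul_self_eq_zero.1 h1
    rw [hR, Matrix.mul_sub, Matrix.mul_one] at this
    exact sub_eq_zero.1 this
  rw [minNormSol, Matrix.mul_assoc, ← hM, Matrix.mul_assoc, Matrix.mul_assoc, h2]

/-- The rows of the minimum norm solution are combinations of the data points. -/
theorem exists_minNormSol_eq_mul_transpose {n p N : ℕ} (X : Matrix (Fin n) (Fin N) ℝ)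
    (Y : Matrix (Fin p) (Fin N) ℝ) : ∃ C : Matrix (Fin p) (Fin N) ℝ, minNormSol X Y = C * Xᵀ := by
  have hP := isMoorePenrose_pinv (X * Xᵀ)
  -- As `M = X * Xᵀ` is symmetric, the Penrose equations give `pinv M = pinv M * (pinv M)ᵀ * M`,
  -- which exhibits `Xᵀ` as a right factor.
  refine ⟨Y * Xᵀ * pinv (X * Xᵀ) * (pinv (X * Xᵀ))ᵀ * X, ?_⟩
  have h1 : (pinv (X * Xᵀ))ᵀ * (X * Xᵀ) = X * Xᵀ * pinv (X * Xᵀ) := by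
    rw [← hP.symm_left, Matrix.transpose_mul, Matrix.transpose_mul, Matrix.transpose_transpose]
  rw [Matrix.mul_assoc, Matrix.mul_assoc _ _ (X * Xᵀ), h1, Matrix.mul_assoc (Y * Xᵀ),
    ← Matrix.mul_assoc (pinv (X * Xᵀ)), hP.self_mul_mul, minNormSol]

/-- Convergence in measure from a vanishing second moment. -/
theorem tendsto_measure_ge_of_integral_sq {Ω : Type*} [MeasurableSpace Ω] {μ : Measure Ω}
    [IsProbabilityMeasure μ] {f : ℕ → Ω → ℝ} (hf0 : ∀ t ω, 0 ≤ f t ω)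
    (hint : ∀ t, Integrable (fun ω => f t ω ^ 2) μ)
    (hlim : Tendsto (fun t => ∫ ω, f t ω ^ 2 ∂μ) atTop (𝓝 0)) {ε : ℝ} (hε : 0 < ε) :
    Tendsto (fun t => μ {ω | ε ≤ f t ω}) atTop (𝓝 0) := by
  rw [← ENNReal.tendsto_toReal_iff (fun t => measure_ne_top _ _) ENNReal.zero_ne_top]
  refine squeeze_zero (g := fun t => (∫ ω, f t ω ^ 2 ∂μ) / ε ^ 2) (fun t => ENNReal.toReal_nonneg)
    (fun t => ?_) (by simpa using hlim.div_const (ε ^ 2))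
  have h := mul_meas_ge_le_integral_of_nonneg (ae_of_all μ fun ω => sq_nonneg (f t ω)) (hint t)
    (ε ^ 2)
  rw [le_div_iff₀ (by positivity), mul_comm]
  have e : {ω | ε ^ 2 ≤ f t ω ^ 2} = {ω | ε ≤ f t ω} := by
    ext ω
    exact pow_le_pow_iff_left₀ hε.le (hf0 t ω) two_ne_zero
  rw [e] at h
  exact h

/-! ### Rows of the iterates and their independence from new batches -/

/-- The minibatch at one time, as indices and noise vectors. -/
noncomputable def minibatch {Ω : Type*} {n N b : ℕ} (k : Fin b → Ω → Fin N)
    (g : Fin n → Fin b → Ω → ℝ) (ω : Ω) :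
    (Fin b → Fin N) × (Fin b → EuclideanSpace ℝ (Fin n)) :=
  (fun j => k j ω, fun j => WithLp.toLp 2 fun i => g i j ω)

/-- The `i`-th row of the iterate. -/
noncomputable def sgdRow {Ω : Type*} {n p N : ℕ} {B : ℕ → ℕ} (X : Matrix (Fin n) (Fin N) ℝ)
    (Y : Matrix (Fin p) (Fin N) ℝ) (η σ : ℕ → ℝ) (W₀ : Matrix (Fin p) (Fin n) ℝ)
    (k : (t : ℕ) → Fin (B t) → Ω → Fin N) (g : (t : ℕ) → Fin n → Fin (B t) → Ω → ℝ)
    (i : Fin p) (t : ℕ) (ω : Ω) : EuclideanSpace ℝ (Fin n) :=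
  WithLp.toLp 2 (sgdIterate X Y η σ W₀ k g t ω i)

theorem frobenius_norm_sq_eq_sum_row {n p : ℕ} (A C : Matrix (Fin p) (Fin n) ℝ) :
    ‖A - C‖ ^ 2 = ∑ i, ‖(WithLp.toLp 2 (A i) - WithLp.toLp 2 (C i) : EuclideanSpace ℝ (Fin n))‖ ^ 2 := by
  rw [Matrix.frobenius_norm_def, ← Real.sqrt_eq_rpow, Real.sq_sqrt (by positivity)]
  simp [EuclideanSpace.norm_sq_eq]

theorem sum_mul_selectionMatrix {N b : ℕ} (f : Fin N → ℝ) (k : Fin b → Fin N) (j : Fin b) :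
    ∑ a, f a * selectionMatrix k a j = f (k j) := by
  simp [selectionMatrix]

theorem measurable_minibatch {Ω : Type*} {_ : MeasurableSpace Ω} {n N b : ℕ} {k : Fin b → Ω → Fin N}
    {g : Fin n → Fin b → Ω → ℝ} (hk : ∀ j, Measurable (k j)) (hg : ∀ i j, Measurable (g i j)) :
    Measurable (minibatch k g) :=
  (measurable_pi_lambda _ hk).prodMk (measurable_pi_lambda _ fun j =>
    (WithLp.measurable_toLp 2 _).comp (measurable_pi_lambda _ fun i => hg i j))

/-- The two factors `√(N / B t)` multiply to `N / B t`, so `2 * η t / N` becomes the batch average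
`2 * η t / B t`; the residual of a row involves only that row. -/
theorem sgdRow_succ {Ω : Type*} {n p N : ℕ} (hN : 0 < N) {B : ℕ → ℕ} (X : Matrix (Fin n) (Fin N) ℝ)
    (Y : Matrix (Fin p) (Fin N) ℝ) (η σ : ℕ → ℝ) (W₀ : Matrix (Fin p) (Fin n) ℝ)
    (k : (t : ℕ) → Fin (B t) → Ω → Fin N) (g : (t : ℕ) → Fin n → Fin (B t) → Ω → ℝ)
    (i : Fin p) (t : ℕ) (ω : Ω) :
    sgdRow X Y η σ W₀ k g i (t + 1) ω =
      sgdStep (fun a => WithLp.toLp 2 (Xᵀ a)) (Y i) (σ t) (η t) (sgdRow X Y η σ W₀ k g i t ω)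
        (minibatch (k t) (g t) ω) := by
  ext l
  have hN' : (0 : ℝ) < N := by exact_mod_cast hN
  have hc : √((N : ℝ) / B t) * √((N : ℝ) / B t) = N / B t := Real.mul_self_sqrt (by positivity)
  simp only [sgdRow, sgdIterate, sgdPath, sgdStep, minibatch]
  set W := sgdPath X Y η σ W₀ (fun s j => k s j ω) (fun s => Matrix.of fun i j => g s i j ω) t
  simp only [PiLp.add_apply, PiLp.smul_apply, Matrix.add_apply, Matrix.smul_apply, smul_eq_mul,
    WithLp.ofLp_sum, Finset.sum_apply, Matrix.mul_apply, Matrix.sub_apply, batchX, batchY,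
    sum_mul_selectionMatrix (fun a => _), Matrix.transpose_apply, PiLp.inner_apply, RCLike.inner_apply,
    conj_trivial, Matrix.of_apply]
  congr 1
  rw [Finset.mul_sum, Finset.mul_sum]
  refine Finset.sum_congr rfl fun j _ => ?_
  have e : ∑ a, W i a * (√((N : ℝ) / B t) * (X a (k t j ω) + σ t * g t a j ω)) =
      √((N : ℝ) / B t) * ∑ a, (X a (k t j ω) + σ t * g t a j ω) * W i a := by
    rw [Finset.mul_sum]
    exact Finset.sum_congr rfl fun a _ => by ring
  rw [e]
  calc _ = 2 * η t / N * (√((N : ℝ) / B t) * √((N : ℝ) / B t)) *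
        ((Y i (k t j ω) - ∑ a, (X a (k t j ω) + σ t * g t a j ω) * W i a) *
          (X l (k t j ω) + σ t * g t l j ω)) := by ring
    _ = _ := by
      rw [hc, show 2 * η t / (N : ℝ) * (N / B t) = 2 * η t / B t by field_simp]

section

variable {Ω : Type*} {n p N : ℕ} {B : ℕ → ℕ}
  {k : (t : ℕ) → Fin (B t) → Ω → Fin N} {g : (t : ℕ) → Fin n → Fin (B t) → Ω → ℝ}

/-- The sources of randomness, indexed by time and position. -/
abbrev noiseSigma (k : (t : ℕ) → Fin (B t) → Ω → Fin N) (g : (t : ℕ) → Fin n → Fin (B t) → Ω → ℝ) :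
    (Σ t, Fin (B t)) ⊕ (Σ t, Fin n × Fin (B t)) → MeasurableSpace Ω :=
  Sum.elim (fun a => MeasurableSpace.comap (k a.1 a.2) inferInstance)
    (fun a => MeasurableSpace.comap (g a.1 a.2.1 a.2.2) inferInstance)

/-- The time index of a source of randomness. -/
def noiseTime : (Σ t, Fin (B t)) ⊕ (Σ t, Fin n × Fin (B t)) → ℕ :=
  Sum.elim Sigma.fst Sigma.fst

theorem measurable_minibatch_iSup (t : ℕ) (S : Set ((Σ t, Fin (B t)) ⊕ (Σ t, Fin n × Fin (B t))))
    (hS : ∀ i, noiseTime i = t → i ∈ S) :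
    Measurable[⨆ i ∈ S, noiseSigma k g i] (minibatch (k t) (g t)) := by
  have hle : ∀ i ∈ S, noiseSigma k g i ≤ ⨆ i ∈ S, noiseSigma k g i := fun i hi =>
    le_iSup₂ (f := fun i (_ : i ∈ S) => noiseSigma k g i) i hi
  have hk : ∀ j, Measurable[⨆ i ∈ S, noiseSigma k g i] (k t j) := fun j =>
    (comap_measurable (k t j)).mono (hle (Sum.inl ⟨t, j⟩) (hS _ rfl)) le_rfl
  have hg : ∀ i j, Measurable[⨆ i ∈ S, noiseSigma k g i] (g t i j) := fun i j =>
    (comap_measurable (g t i j)).mono (hle (Sum.inr ⟨t, i, j⟩) (hS _ rfl)) le_rfl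
  exact measurable_minibatch hk hg

/-- Adaptedness: the row at time `t` is a function of the sources at times strictly before `t`,
because the minibatch at time `t` first enters the row at `t + 1`. -/
theorem measurable_sgdRow_iSup (hN : 0 < N) (X : Matrix (Fin n) (Fin N) ℝ)
    (Y : Matrix (Fin p) (Fin N) ℝ) (η σ : ℕ → ℝ) (W₀ : Matrix (Fin p) (Fin n) ℝ) (i : Fin p)
    (t : ℕ) : Measurable[⨆ a ∈ {a | noiseTime a < t}, noiseSigma k g a]
      (sgdRow X Y η σ W₀ k g i t) := by
  induction t with
  | zero =>
    have : sgdRow X Y η σ W₀ k g i 0 = fun _ => WithLp.toLp 2 (W₀ i) := rfl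
    rw [this]
    exact measurable_const
  | succ t ih =>
    have h1 : Measurable[⨆ a ∈ {a | noiseTime a < t + 1}, noiseSigma k g a]
        (sgdRow X Y η σ W₀ k g i t) :=
      ih.mono (biSup_mono fun a (ha : noiseTime a < t) => Nat.lt_succ_of_lt ha) le_rfl
    have h2 := measurable_minibatch_iSup (k := k) (g := g) t {a | noiseTime a < t + 1}
      fun a ha => by simp [ha]
    have h3 := (measurable_sgdStep (b := B t) (fun a => WithLp.toLp 2 (Xᵀ a)) (Y i) (σ t) (η t)).comp
      (h1.prodMk h2)
    convert h3 using 1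
    funext ω
    exact sgdRow_succ hN X Y η σ W₀ k g i t ω

variable [MeasurableSpace Ω] {μ : Measure Ω}

namespace IsBatchNoise

theorem noiseSigma_le (h : IsBatchNoise μ k g)
    (a : (Σ t, Fin (B t)) ⊕ (Σ t, Fin n × Fin (B t))) :
    noiseSigma k g a ≤ ‹MeasurableSpace Ω› := by
  rcases a with a | a
  · exact (h.measurable_k a.1 a.2).comap_le
  · exact (h.measurable_g a.1 a.2.1 a.2.2).comap_le

theorem measurable_sgdRow (h : IsBatchNoise μ k g) (hN : 0 < N) (X : Matrix (Fin n) (Fin N) ℝ)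
    (Y : Matrix (Fin p) (Fin N) ℝ) (η σ : ℕ → ℝ) (W₀ : Matrix (Fin p) (Fin n) ℝ) (i : Fin p)
    (t : ℕ) : Measurable (sgdRow X Y η σ W₀ k g i t) :=
  (measurable_sgdRow_iSup hN X Y η σ W₀ i t).mono
    (iSup₂_le fun a _ => h.noiseSigma_le a) le_rfl

/-- The iterate and the new minibatch are measurable with respect to disjoint families of
independent sources. -/
theorem indepFun_sgdRow_minibatch (h : IsBatchNoise μ k g) (hN : 0 < N)
    (X : Matrix (Fin n) (Fin N) ℝ)
    (Y : Matrix (Fin p) (Fin N) ℝ) (η σ : ℕ → ℝ) (W₀ : Matrix (Fin p) (Fin n) ℝ) (i : Fin p)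
    (t : ℕ) : IndepFun (sgdRow X Y η σ W₀ k g i t) (minibatch (k t) (g t)) μ := by
  have hdisj : Disjoint {a : (Σ t, Fin (B t)) ⊕ (Σ t, Fin n × Fin (B t)) | noiseTime a < t}
      {a | noiseTime a = t} :=
    Set.disjoint_left.2 fun a h1 h2 => (show noiseTime a < t from h1).ne h2
  have h1 := indep_iSup_of_disjoint h.noiseSigma_le h.indep hdisj
  rw [IndepFun_iff_Indep]
  exact indep_of_indep_of_le_right (indep_of_indep_of_le_left h1
    (measurable_sgdRow_iSup hN X Y η σ W₀ i t).comap_le)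
    (measurable_minibatch_iSup t _ fun a ha => ha).comap_le

theorem isUniformGaussianPair (h : IsBatchNoise μ k g) (t : ℕ) (j : Fin (B t)) :
    IsUniformGaussianPair μ (fun ω => (minibatch (k t) (g t) ω).1 j)
      (fun ω => (minibatch (k t) (g t) ω).2 j) where
  measurable_fst := h.measurable_k t j
  measurable_snd := (WithLp.measurable_toLp 2 _).comp
    (measurable_pi_lambda _ fun i => h.measurable_g t i j)
  law_fst := h.law_k t j
  law_snd i := h.law_g t i j
  indep_fst i := by
    rw [IndepFun_iff_Indep]
    exact h.indep.indep (i := Sum.inl ⟨t, j⟩) (j := Sum.inr ⟨t, i, j⟩) (by simp)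
  indep_snd i i' hi := by
    rw [IndepFun_iff_Indep]
    exact h.indep.indep (i := Sum.inr ⟨t, i, j⟩) (j := Sum.inr ⟨t, i', j⟩) (by simpa using hi)

end IsBatchNoise

/-! ### Assembling the theorem -/

/-- Mean square convergence of one row to the corresponding row of the minimum norm solution, with
a rate for polynomially decaying parameters. Divergence of `∑ η t * σ t ^ 2` suffices: in the
orthogonal complement of the data the gradient noise itself carries a factor `σ t`. -/
theorem IsBatchNoise.tendsto_integral_norm_sgdRow_sub_sq [IsProbabilityMeasure μ]
    (hkg : IsBatchNoise μ k g) (hN : 0 < N) (hB : ∀ t, 1 ≤ B t)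
    (X : Matrix (Fin n) (Fin N) ℝ) (Y : Matrix (Fin p) (Fin N) ℝ)
    {η σ : ℕ → ℝ} (hη0 : ∀ t, 0 ≤ η t) (hη : Tendsto η atTop (𝓝 0))
    (hσ_anti : Antitone fun t => σ t ^ 2) (hσ : Tendsto (fun t => σ t ^ 2) atTop (𝓝 0))
    (hdiv : Tendsto (fun T : ℕ => ∑ t ∈ Finset.range T, η t * σ t ^ 2) atTop atTop)
    (W₀ : Matrix (Fin p) (Fin n) ℝ) (i : Fin p) :
    (∀ t, Integrable (fun ω => ‖sgdRow X Y η σ W₀ k g i t ω -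
      WithLp.toLp 2 (minNormSol X Y i)‖ ^ 2) μ) ∧
    Tendsto (fun t => ∫ ω, ‖sgdRow X Y η σ W₀ k g i t ω -
      WithLp.toLp 2 (minNormSol X Y i)‖ ^ 2 ∂μ) atTop (𝓝 0) ∧
    ∀ x y : ℝ, 0 < x → 0 < y → x + y < 1 → η =Θ[atTop] (fun t : ℕ => (t : ℝ) ^ (-x)) →
      (fun t => σ t ^ 2) =Θ[atTop] (fun t : ℕ => (t : ℝ) ^ (-y)) →
      ∃ D, ∀ᶠ t : ℕ in atTop, ∫ ω, ‖sgdRow X Y η σ W₀ k g i t ω -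
        WithLp.toLp 2 (minNormSol X Y i)‖ ^ 2 ∂μ ≤ D * (t : ℝ) ^ (-(2 * min y (x / 2))) := by
  set w' : EuclideanSpace ℝ (Fin n) := WithLp.toLp 2 (minNormSol X Y i) with hw'
  set ξ : Fin N → EuclideanSpace ℝ (Fin n) := fun a => WithLp.toLp 2 (Xᵀ a) with hξ
  set S := Submodule.span ℝ (Set.range ξ) with hS
  have hmem : w' ∈ S := by
    obtain ⟨C, hC⟩ := exists_minNormSol_eq_mul_transpose X Y
    have : w' = ∑ a, C i a • ξ a := by
      ext l
      simp [hw', hC, hξ, Matrix.mul_apply]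
    rw [this]
    exact Submodule.sum_mem _ fun a _ => Submodule.smul_mem _ _ (Submodule.subset_span ⟨a, rfl⟩)
  have hnormal : ∑ a, (Y i a - inner ℝ w' (ξ a)) • ξ a = 0 := by
    have h1 := minNormSol_mul_mul_transpose X Y
    ext l
    have h2 := congrFun (congrFun h1 i) l
    have h3 : ∀ a, inner ℝ w' (ξ a) = (minNormSol X Y * X) i a := fun a => by
      simp [hw', hξ, PiLp.inner_apply, Matrix.mul_apply, mul_comm]
    rw [Matrix.mul_apply, Matrix.mul_apply] at h2
    simp only [h3, WithLp.ofLp_sum, Finset.sum_apply, PiLp.smul_apply, smul_eq_mul, sub_mul,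
      Finset.sum_sub_distrib, PiLp.zero_apply]
    exact sub_eq_zero.2 h2.symm
  obtain ⟨hint, l, C, hl, hC, hrec⟩ := exists_moment_recursion (μ := μ) hN hB ξ (Y i) hη0
    (fun t => hσ_anti (Nat.zero_le t)) (fun t => minibatch (k t) (g t)) hkg.isUniformGaussianPair
    (sgdRow X Y η σ W₀ k g i) (WithLp.toLp 2 (W₀ i)) (fun ω => rfl)
    (sgdRow_succ hN X Y η σ W₀ k g i) (hkg.measurable_sgdRow hN X Y η σ W₀ i)
    (hkg.indepFun_sgdRow_minibatch hN X Y η σ W₀ i) w' S hS hmem hnormal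
  set a : ℕ → ℝ := fun t => ∫ ω, ‖S.starProjection (sgdRow X Y η σ W₀ k g i t ω - w')‖ ^ 2 ∂μ
  set u : ℕ → ℝ := fun t => ∫ ω, ‖Sᗮ.starProjection (sgdRow X Y η σ W₀ k g i t ω - w')‖ ^ 2 ∂μ
  have ha0 : ∀ t, 0 ≤ a t := fun t => integral_nonneg fun ω => sq_nonneg _
  have hu0 : ∀ t, 0 ≤ u t := fun t => integral_nonneg fun ω => sq_nonneg _
  have hsum : ∀ t, ∫ ω, ‖sgdRow X Y η σ W₀ k g i t ω - w'‖ ^ 2 ∂μ = a t + u t := fun t => by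
    simp only [S.norm_sq_eq_add_norm_sq_starProjection (_ - w')]
    exact integral_add (hint t).1 (hint t).2
  obtain ⟨⟨A, hA1, hA⟩, hlima, hlimu⟩ := tendsto_zero_of_moment_recursion hl hC ha0 hu0 hη0 hη
    (fun t => sq_nonneg (σ t)) (fun t => hσ_anti (Nat.zero_le t)) hσ hdiv
    (fun t => (hrec t).1) (fun t => (hrec t).2)
  simp only [hsum]
  refine ⟨fun t => ?_, by simpa using hlima.add hlimu, fun x y hx hy hxy hηx hσy => ?_⟩
  · simp only [S.norm_sq_eq_add_norm_sq_starProjection (_ - w')]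
    exact (hint t).1.add (hint t).2
  · exact exists_rate_of_moment_recursion hl hC hA1 ha0 hu0 hη0 (fun t => sq_nonneg (σ t)) hx hy hxy
      hηx hσy hA (fun t => (hrec t).1) (fun t => (hrec t).2)

end

theorem theorem6p2 {Ω : Type*} [MeasurableSpace Ω] (μ : Measure Ω) [IsProbabilityMeasure μ]
    {n p N : ℕ} (hN : 0 < N) (hNn : N < n)
    (X : Matrix (Fin n) (Fin N) ℝ) (Y : Matrix (Fin p) (Fin N) ℝ)
    (B : ℕ → ℕ) (hB : ∀ t, 1 ≤ B t)
    (k : (t : ℕ) → Fin (B t) → Ω → Fin N) (g : (t : ℕ) → Fin n → Fin (B t) → Ω → ℝ)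
    (hkg : IsBatchNoise μ k g)
    (η σ : ℕ → ℝ) (hη_nonneg : ∀ t, 0 ≤ η t) (hη : Tendsto η atTop (𝓝 0))
    (hσ_anti : Antitone fun t => σ t ^ 2) (hσ : Tendsto (fun t => σ t ^ 2) atTop (𝓝 0))
    (hdiv : ∀ C : ℝ, 0 < C →
      Tendsto (fun T : ℕ => ∑ t ∈ Finset.range T, (η t * σ t ^ 2 - C * η t ^ 2)) atTop atTop)
    (hsum : Summable fun t => η t ^ 2 * σ t ^ 2)
    (W₀ : Matrix (Fin p) (Fin n) ℝ) :
    TendstoInMeasure μ (sgdIterate X Y η σ W₀ k g) atTop (fun _ => minNormSol X Y) ∧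
    ∀ x y : ℝ, 0 < x → 0 < y → x + y < 1 → 1 < 2 * x + y →
      η =Θ[atTop] (fun t : ℕ => (t : ℝ) ^ (-x)) →
      (fun t => σ t ^ 2) =Θ[atTop] (fun t : ℕ => (t : ℝ) ^ (-y)) →
      ∀ ε : ℝ, 0 < ε →
        TendstoInMeasure μ
          (fun (t : ℕ) ω => (t : ℝ) ^ (min y (x / 2) - ε) *
            ‖sgdIterate X Y η σ W₀ k g t ω - minNormSol X Y‖)
          atTop (fun _ => 0) := by
  -- Adding back the nonnegative terms `η t ^ 2` preserves divergence, so the case `C = 1` suffices.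
  have hdiv' : Tendsto (fun T : ℕ => ∑ t ∈ Finset.range T, η t * σ t ^ 2) atTop atTop :=
    tendsto_atTop_mono (fun T => Finset.sum_le_sum fun t _ => by
      have := sq_nonneg (η t); linarith) (hdiv 1 one_pos)
  have hrow := hkg.tendsto_integral_norm_sgdRow_sub_sq hN hB X Y hη_nonneg hη hσ_anti hσ hdiv' W₀
  have hnorm : ∀ t ω, ‖sgdIterate X Y η σ W₀ k g t ω - minNormSol X Y‖ ^ 2 =
      ∑ i, ‖sgdRow X Y η σ W₀ k g i t ω - WithLp.toLp 2 (minNormSol X Y i)‖ ^ 2 :=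
    fun t ω => frobenius_norm_sq_eq_sum_row _ _
  have hint : ∀ t, Integrable
      (fun ω => ‖sgdIterate X Y η σ W₀ k g t ω - minNormSol X Y‖ ^ 2) μ := fun t => by
    simp only [hnorm]
    exact integrable_finsetSum _ fun i _ => (hrow i).1 t
  have hintegral : ∀ t, ∫ ω, ‖sgdIterate X Y η σ W₀ k g t ω - minNormSol X Y‖ ^ 2 ∂μ =
      ∑ i, ∫ ω, ‖sgdRow X Y η σ W₀ k g i t ω - WithLp.toLp 2 (minNormSol X Y i)‖ ^ 2 ∂μ :=
    fun t => by
      simp only [hnorm]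
      exact integral_finsetSum _ fun i _ => (hrow i).1 t
  refine ⟨?_, fun x y hx hy hxy _ hηx hσy ε hε => ?_⟩
  · rw [tendstoInMeasure_iff_norm]
    intro δ hδ
    refine tendsto_measure_ge_of_integral_sq (fun t ω => norm_nonneg _) hint ?_ hδ
    simp only [hintegral]
    simpa using tendsto_finsetSum Finset.univ fun i _ => (hrow i).2.1
  · rw [tendstoInMeasure_iff_norm]
    intro δ hδ
    simp only [sub_zero, norm_mul, norm_norm]
    refine tendsto_measure_ge_of_integral_sq (fun t ω => by positivity) (fun t => ?_) ?_ hδ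
    · simp only [mul_pow]
      exact (hint t).const_mul _
    simp only [mul_pow, integral_const_mul, hintegral]
    choose D hD using fun i => (hrow i).2.2 x y hx hy hxy hηx hσy
    set r := min y (x / 2)
    -- The squared weight `t ^ (2 * (r - ε))` times the decay `t ^ (-(2 * r))` leaves `t ^ (-(2 *
    -- ε))`.
    have hlim : Tendsto (fun t : ℕ => (∑ i, D i) * (t : ℝ) ^ (-(2 * ε))) atTop (𝓝 0) := by
      simpa using ((tendsto_rpow_neg_atTop (show 0 < 2 * ε by positivity)).comp
        tendsto_natCast_atTop_atTop).const_mul (∑ i, D i)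
    refine squeeze_zero' (Eventually.of_forall fun t => ?_) ?_ hlim
    · exact mul_nonneg (by positivity) (Finset.sum_nonneg fun i _ =>
        integral_nonneg fun ω => by positivity)
    filter_upwards [eventually_all.2 hD, eventually_ge_atTop 1] with t ht ht1
    have htp : (0 : ℝ) < t := by exact_mod_cast ht1
    have e : ‖(t : ℝ) ^ (r - ε)‖ ^ 2 = (t : ℝ) ^ (2 * (r - ε)) := by
      rw [Real.norm_of_nonneg (by positivity), ← Real.rpow_natCast, ← Real.rpow_mul htp.le]
      congr 1; push_cast; ring
    calc _ ≤ (t : ℝ) ^ (2 * (r - ε)) * ∑ i, D i * (t : ℝ) ^ (-(2 * r)) := by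
          rw [e]
          gcongr with i
          exact ht i
      _ = (∑ i, D i) * ((t : ℝ) ^ (2 * (r - ε)) * (t : ℝ) ^ (-(2 * r))) := by
          rw [← Finset.sum_mul]; ring
      _ = _ := by rw [← Real.rpow_add htp]; congr 2; ring
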